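/- Let $n\ge 1$, $1<p<\infty$ and $0<\alpha<n$. A weight is a locally integrable function $v$ on $\mathbb R^n$ with $0<v<\infty$ almost everywhere; write $v(E)=\int_E v(x)\,dx$. For $1<q<\infty$, $v\in A_q$ means that there is $C>0$ with $$\Big(\int_Q v\Big)\Big(\int_Q v^{1-q'}\Big)^{q-1}\le C|Q|^q,\qquad \tfrac1q+\tfrac1{q'}=1,$$ for all cubes $Q$ (with sides parallel to the axes), $v\in A_1$ means that there is $C>0$ with $\frac{1}{|Q|}\int_Q v\le C\operatorname{ess\,inf}_Q v$ for all cubes $Q$, and $A_\infty=\bigcup_{1\le q<\infty}A_q$. Let $v\in A_\infty$ and let $\omega$ be a positive continuous function on $\mathbb R^n\times(0,\infty)$. For a nonnegative measurable $g:\mathbb R^n\to[0,\infty]$ put $$\|g\|_{\mathcal M_{p,\omega}(\mathbb R^n,v)}=\sup_{x\in\mathbb R^n,\ r>0}\omega(x,r)\Big(\int_{B(x,r)}g(y)^p v(y)\,dy\Big)^{1/p}\in[0,\infty],$$ and for a nonnegative locally integrable function $f$ on $\mathbb R^n$ put $$I_\alpha f(x)=\int_{\mathbb R^n}\frac{f(y)\,dy}{|x-y|^{n-\alpha}},\qquad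 M_\alpha f(x)=\sup_{r>0}\frac{1}{|B(x,r)|^{1-\alpha/n}}\int_{B(x,r)}f(y)\,dy,$$ where $B(x,r)$ is the open ball with centre $x$ and radius $r$. Define $$\psi(x,t)=\sup_{t<s<\infty}s^{\alpha-n}\sup_{0<\tau<s}\omega(x,\tau)\,v(B(x,\tau))^{1/p}\in(0,\infty],$$ and suppose that (with the conventions $1/\infty=0$ and $\infty\cdot 0=0$) $$\sup_{x\in\mathbb R^n}\ \sup_{s>0}\ s^{n-\alpha}\,\psi(x,s)\int_s^\infty t^{\alpha-n-1}\,\psi(x,t)^{-1}\,dt<\infty.$$ Then there exists a constant $C>0$, independent of $f$, such that for every nonnegative locally integrable function $f$ on $\mathbb R^n$ $$C^{-1}\|M_\alpha f\|_{\mathcal M_{p,\omega}(\mathbb R^n,v)}\le\|I_\alpha f\|_{\mathcal M_{p,\omega}(\mathbb R^n,v)}\le C\,\|M_\alpha f\|_{\mathcal M_{p,\omega}(\mathbb R^n,v)},$$ where the norms may take the value $\infty$. -/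

import Mathlib

open MeasureTheory Set
open scoped ENNReal NNReal

noncomputable section

namespace Morrey

/-- A weight on `ℝⁿ`: a locally integrable function, positive (and finite) almost everywhere. -/
def IsWeight {n : ℕ} (v : EuclideanSpace ℝ (Fin n) → ℝ) : Prop :=
  LocallyIntegrable v volume ∧ ∀ᵐ x ∂(volume : Measure (EuclideanSpace ℝ (Fin n))), 0 < v x

/-- The open cube with sides parallel to the axes, centre `x` and side length `2 * r`. -/
def cube {n : ℕ} (x : EuclideanSpace ℝ (Fin n)) (r : ℝ) : Set (EuclideanSpace ℝ (Fin n)) :=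
  {y | ∀ i, |y i - x i| < r}

/-- The measure `v(E) = ∫_E v(x) dx` of a set `E`. -/
def wMeas {n : ℕ} (v : EuclideanSpace ℝ (Fin n) → ℝ) (E : Set (EuclideanSpace ℝ (Fin n))) : ℝ≥0∞ :=
  ∫⁻ x in E, ENNReal.ofReal (v x)

/-- The Muckenhoupt class `A_1`. -/
def MuckenhouptAOne {n : ℕ} (v : EuclideanSpace ℝ (Fin n) → ℝ) : Prop :=
  IsWeight v ∧ ∃ C : ℝ≥0, ∀ (x : EuclideanSpace ℝ (Fin n)) (r : ℝ), 0 < r →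
    wMeas v (cube x r) / volume (cube x r) ≤
      C * essInf (fun y => ENNReal.ofReal (v y)) (volume.restrict (cube x r))

/-- The Muckenhoupt class `A_q`, for `1 < q < ∞`. -/
def MuckenhouptA {n : ℕ} (q : ℝ) (v : EuclideanSpace ℝ (Fin n) → ℝ) : Prop :=
  IsWeight v ∧ ∃ C : ℝ≥0, ∀ (x : EuclideanSpace ℝ (Fin n)) (r : ℝ), 0 < r →
    wMeas v (cube x r) *
        (∫⁻ y in cube x r, ENNReal.ofReal (v y) ^ (1 - Real.conjExponent q)) ^ (q - 1) ≤
      C * volume (cube x r) ^ q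

/-- The class `A_∞`, the union of the classes `A_q` over `1 ≤ q < ∞`. -/
def MuckenhouptAInfty {n : ℕ} (v : EuclideanSpace ℝ (Fin n) → ℝ) : Prop :=
  MuckenhouptAOne v ∨ ∃ q : ℝ, 1 < q ∧ MuckenhouptA q v

/-- The Riesz potential `I_α f` of a nonnegative function. -/
def rieszPotential {n : ℕ} (α : ℝ) (f : EuclideanSpace ℝ (Fin n) → ℝ)
    (x : EuclideanSpace ℝ (Fin n)) : ℝ≥0∞ :=
  ∫⁻ y, ENNReal.ofReal (f y) / ENNReal.ofReal (‖x - y‖ ^ ((n : ℝ) - α))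

/-- The fractional maximal function `M_α f` of a nonnegative function. -/
def fracMaximal {n : ℕ} (α : ℝ) (f : EuclideanSpace ℝ (Fin n) → ℝ)
    (x : EuclideanSpace ℝ (Fin n)) : ℝ≥0∞ :=
  ⨆ r : ℝ, ⨆ _ : 0 < r,
    (∫⁻ y in Metric.ball x r, ENNReal.ofReal (f y)) / volume (Metric.ball x r) ^ (1 - α / (n : ℝ))

/-- The weighted Lebesgue norm `(∫_E g^p v)^{1/p}` of a nonnegative extended-real function. -/
def wLpNorm {n : ℕ} (p : ℝ) (v : EuclideanSpace ℝ (Fin n) → ℝ) (E : Set (EuclideanSpace ℝ (Fin n)))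
    (g : EuclideanSpace ℝ (Fin n) → ℝ≥0∞) : ℝ≥0∞ :=
  (∫⁻ x in E, g x ^ p * ENNReal.ofReal (v x)) ^ (1 / p)

/-- The norm of the generalized weighted Morrey space `M_{p,ω}(ℝⁿ, v)`, which is `∞` for functions
outside the space. -/
def morreyNorm {n : ℕ} (p : ℝ) (ω : EuclideanSpace ℝ (Fin n) → ℝ → ℝ)
    (v : EuclideanSpace ℝ (Fin n) → ℝ) (g : EuclideanSpace ℝ (Fin n) → ℝ≥0∞) : ℝ≥0∞ :=
  ⨆ x : EuclideanSpace ℝ (Fin n), ⨆ r : ℝ, ⨆ _ : 0 < r,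
    ENNReal.ofReal (ω x r) * wLpNorm p v (Metric.ball x r) g

/-- `ψ(x,t) = sup_{s > t} s^{α-n} sup_{0 < τ < s} ω(x,τ) v(B(x,τ))^{1/p}`, with values in `[0,∞]`. -/
def psi {n : ℕ} (p α : ℝ) (ω : EuclideanSpace ℝ (Fin n) → ℝ → ℝ)
    (v : EuclideanSpace ℝ (Fin n) → ℝ) (x : EuclideanSpace ℝ (Fin n)) (t : ℝ) : ℝ≥0∞ :=
  ⨆ s ∈ Ioi t, ENNReal.ofReal (s ^ (α - (n : ℝ))) *
    ⨆ τ ∈ Ioo 0 s, ENNReal.ofReal (ω x τ) * wMeas v (Metric.ball x τ) ^ (1 / p)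

end Morrey

end

/-!
The maximal function is pointwise bounded by the Riesz potential, since the average of `f` over
`B(y, ρ)` is at most the part of the potential coming from that ball. So the content is the bound
for the potential. Write `d = n - α`, let `μ = v dx` and `ν = f dx`, and consider the averages
`ballAvg d ν ρ y = ρ ^ (-d) ν(B(y, ρ))`. On a ball `B(x, r)` the potential splits into two parts.

*Near part.* The part of the potential within distance `2 r` is at most a constant times the sum
over `k` of the averages `a k` at the dyadic scales `16 r / 2 ^ (k + 2)`
(`setLIntegral_ball_riesz_le`), and `exists_setLIntegral_sum_rpow_le` bounds the `L ^ p (μ)` norm of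
this sum over `B(x, r)` by that of the supremum of the averages, hence of the maximal function.
Since `ω` is arbitrary at different radii, it matters that the ball is the same on both sides. The
proof is a direct substitute for a good-`λ` inequality or a sparse selection. The power of the sum
is at most `p ∑ a k * S k ^ (p - 1)`, with `S k` the partial sums. In volume average, the averages
decay geometrically as the scale shrinks, so each ball of radius `ρ` centred in `B(x, r)` contains,
inside `B(x, r)`, a fixed proportion of points at which the sum over scales far below `ρ` is
dominated by the scale `4 ρ` (`exists_volume_tail_le`). By the Muckenhoupt condition these points
also carry a fixed proportion of `μ` (`FatSets`, `exists_measure_ball_le_good`). Moving the integral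
of the `k`-th term to such points (`lintegral_le_of_fat`), only those `k` for which `a k` dominates
its own tail remain at each point, and their sum is at most a constant times `sup a`
(`sum_filter_le_of_tail_le`). What is left is the integral of `sup a * (∑ a + sup a) ^ (p - 1)`, and
Young's inequality absorbs the power of the sum.

*Far part.* It is at most a constant times `∫_r^∞ t ^ (-d - 1) ν(B(x, t)) dt`
(`setLIntegral_compl_ball_riesz_le`). A lower bound for the maximal function on balls centred at `x`
gives `psi x t * ν(B(x, t)) ≤ C N`, where `N` is the Morrey norm of the maximal function
(`psi_mul_le`). Inserting this, the hypothesis on `psi` bounds the far part by `N`.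
-/

open Metric

namespace Morrey

variable {n : ℕ}

/-! ### Inequalities for finite sums -/

lemma real_rpow_add_le {p s a : ℝ} (hp : 1 ≤ p) (hs : 0 ≤ s) (ha : 0 ≤ a) :
    (s + a) ^ p ≤ s ^ p + p * (a * (s + a) ^ (p - 1)) := by
  rcases eq_or_lt_of_le (add_nonneg hs ha) with h0 | h0
  · have hs0 : s = 0 := by linarith
    have ha0 : a = 0 := by linarith
    simp [hs0, ha0]
  · set t : ℝ := s + a with ht
    have h1 : -1 ≤ -(a / t) := by
      have : a / t ≤ 1 := (div_le_one h0).2 (by linarith)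
      linarith
    have hb := one_add_mul_self_le_rpow_one_add h1 hp
    have h2 : 1 + -(a / t) = s / t := by
      rw [← sub_eq_add_neg, eq_div_iff h0.ne', sub_mul, div_mul_cancel₀ _ h0.ne']
      linarith
    rw [h2, Real.div_rpow hs h0.le, le_div_iff₀ (Real.rpow_pos_of_pos h0 _)] at hb
    have h3 : t ^ p = t * t ^ (p - 1) := by
      rw [Real.rpow_sub_one h0.ne']; field_simp
    have h4 : (1 + p * -(a / t)) * t ^ p = t ^ p - p * (a * t ^ (p - 1)) := by
      rw [h3]; field_simp; ring
    linarith

lemma rpow_add_le_rpow_add_mul {p : ℝ} (hp : 1 ≤ p) (s a : ℝ≥0∞) (hs : s ≠ ∞) (ha : a ≠ ∞) :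
    (s + a) ^ p ≤ s ^ p + ENNReal.ofReal p * (a * (s + a) ^ (p - 1)) := by
  have hp0 : 0 ≤ p := by linarith
  obtain ⟨s, hs₀, rfl⟩ : ∃ s' : ℝ, 0 ≤ s' ∧ s = ENNReal.ofReal s' :=
    ⟨s.toReal, ENNReal.toReal_nonneg, (ENNReal.ofReal_toReal hs).symm⟩
  obtain ⟨a, ha₀, rfl⟩ : ∃ a' : ℝ, 0 ≤ a' ∧ a = ENNReal.ofReal a' :=
    ⟨a.toReal, ENNReal.toReal_nonneg, (ENNReal.ofReal_toReal ha).symm⟩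
  rw [← ENNReal.ofReal_add hs₀ ha₀, ENNReal.ofReal_rpow_of_nonneg (by positivity) hp0,
    ENNReal.ofReal_rpow_of_nonneg hs₀ hp0,
    ENNReal.ofReal_rpow_of_nonneg (by positivity) (by linarith), ← ENNReal.ofReal_mul ha₀,
    ← ENNReal.ofReal_mul hp0, ← ENNReal.ofReal_add (by positivity) (by positivity)]
  exact ENNReal.ofReal_le_ofReal (real_rpow_add_le hp hs₀ ha₀)

/-- Discrete form of `T ^ p = ∫ p S ^ (p - 1) dS`: each term of the sum is paired only with the
partial sum up to it. -/
lemma sum_range_rpow_le {p : ℝ} (hp : 1 ≤ p) (a : ℕ → ℝ≥0∞) (ha : ∀ k, a k ≠ ∞) (N : ℕ) :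
    (∑ k ∈ Finset.range N, a k) ^ p ≤ ENNReal.ofReal p *
      ∑ k ∈ Finset.range N, a k * (∑ i ∈ Finset.range (k + 1), a i) ^ (p - 1) := by
  induction N with
  | zero => simp [show 0 < p by linarith]
  | succ N ih =>
    rw [Finset.sum_range_succ (n := N) (f := fun k => a k * _), mul_add]
    have hfin : ∑ k ∈ Finset.range N, a k ≠ ∞ := ENNReal.sum_ne_top.2 fun k _ => ha k
    calc _ = (∑ k ∈ Finset.range N, a k + a N) ^ p := by rw [Finset.sum_range_succ]
      _ ≤ _ := rpow_add_le_rpow_add_mul hp _ _ hfin (ha N)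
      _ ≤ _ := by
        rw [Finset.sum_range_succ (n := N) (f := a)]
        gcongr

/-- If `a k` dominates the tail of the sequence beyond `k + m` whenever `k ∈ s`, then the first
element of `s` controls all of `∑ k ∈ s, a k` up to the `m` terms right after it. -/
lemma sum_filter_le_of_tail_le (a : ℕ → ℝ≥0∞) (M : ℝ≥0∞) (hM : ∀ k, a k ≤ M) (m K : ℕ)
    (s : Finset ℕ) (hs : s ⊆ Finset.range K)
    (htail : ∀ k ∈ s, ∑ j ∈ Finset.range K, a (k + m + j) ≤ a k) :
    ∑ k ∈ s, a k ≤ (m + 1) * M := by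
  rcases s.eq_empty_or_nonempty with rfl | hne
  · simp
  set k₀ := s.min' hne
  have hk₀ : k₀ ∈ s := s.min'_mem hne
  have hsub : s ⊆ (Finset.range m).image (k₀ + ·) ∪
      (Finset.range K).image (k₀ + m + ·) := by
    intro k hk
    have h1 : k₀ ≤ k := s.min'_le k hk
    have h2 : k < K := Finset.mem_range.1 (hs hk)
    simp only [Finset.mem_union, Finset.mem_image, Finset.mem_range]
    rcases lt_or_ge k (k₀ + m) with h | h
    · exact Or.inl ⟨k - k₀, by omega, by omega⟩
    · exact Or.inr ⟨k - (k₀ + m), by omega, by omega⟩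
  calc ∑ k ∈ s, a k ≤ ∑ k ∈ (Finset.range m).image (k₀ + ·) ∪
      (Finset.range K).image (k₀ + m + ·), a k := Finset.sum_le_sum_of_subset hsub
    _ ≤ ∑ k ∈ (Finset.range m).image (k₀ + ·), a k +
        ∑ k ∈ (Finset.range K).image (k₀ + m + ·), a k := by
        rw [← Finset.sum_union_inter]; exact le_self_add
    _ = ∑ k ∈ Finset.range m, a (k₀ + k) + ∑ j ∈ Finset.range K, a (k₀ + m + j) := by
        rw [Finset.sum_image (by intro _ _ _ _; simp), Finset.sum_image (by intro _ _ _ _; simp)]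
    _ ≤ ∑ k ∈ Finset.range m, M + M :=
        add_le_add (Finset.sum_le_sum fun k _ => hM _) ((htail k₀ hk₀).trans (hM _))
    _ = (m + 1) * M := by simp [add_mul]

/-- A form of Young's inequality, with the two regimes `M ≥ ε T` and `M < ε T` separated. -/
lemma exists_mul_rpow_le {p : ℝ} (hp : 1 < p) (C : ℝ≥0) :
    ∃ C' : ℝ≥0, ∀ T M : ℝ≥0∞,
      (C : ℝ≥0∞) * (M * (T + M) ^ (p - 1)) ≤ 2⁻¹ * T ^ p + C' * M ^ p := by
  -- beyond the threshold `T ≥ A M`, the left side is at most `C A⁻¹ (2 T) ^ p / 2 ≤ T ^ p / 2`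
  set A : ℝ≥0 := C * 2 ^ p + 1 with hA
  have hA1 : 1 ≤ A := by simp [hA]
  refine ⟨C * (A + 1) ^ (p - 1), fun T M => ?_⟩
  have hp1 : 0 ≤ p - 1 := by linarith
  have split (x : ℝ≥0∞) : x ^ p = x * x ^ (p - 1) := by
    conv_lhs => rw [show p = 1 + (p - 1) by ring]
    rw [ENNReal.rpow_add_of_nonneg _ _ zero_le_one hp1, ENNReal.rpow_one]
  rcases le_total T (A * M) with h | h
  · refine le_add_left ?_
    calc (C : ℝ≥0∞) * (M * (T + M) ^ (p - 1)) ≤ C * (M * ((A + 1) * M) ^ (p - 1)) := by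
          gcongr
          rw [add_mul, one_mul]; gcongr
      _ = _ := by
          rw [ENNReal.mul_rpow_of_nonneg _ _ hp1, split M]
          push_cast
          rw [ENNReal.coe_rpow_of_nonneg _ hp1]
          push_cast
          ring
  · refine le_add_right ?_
    have hMT : M ≤ T := le_trans (by
      calc M = 1 * M := (one_mul _).symm
        _ ≤ A * M := by gcongr; exact_mod_cast hA1) h
    have hA0 : (A : ℝ≥0∞) ≠ 0 := by exact_mod_cast (by positivity : (0 : ℝ≥0) < A).ne'
    have hMA : M ≤ (A : ℝ≥0∞)⁻¹ * T := by
      rw [mul_comm, ← div_eq_mul_inv, ENNReal.le_div_iff_mul_le (Or.inl hA0)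
        (Or.inl ENNReal.coe_ne_top), mul_comm]
      exact h
    have h2 : (C : ℝ≥0∞) * 2 ^ (p - 1) ≤ 2⁻¹ * A := by
      rw [← ENNReal.mul_le_mul_iff_right (a := 2) (by simp) (by simp), ← mul_assoc 2 2⁻¹,
        ENNReal.mul_inv_cancel (by simp) (by simp), one_mul]
      calc (2 : ℝ≥0∞) * (C * 2 ^ (p - 1)) = C * 2 ^ p := by rw [split 2]; ring
        _ = ((C * 2 ^ p : ℝ≥0) : ℝ≥0∞) := by
          push_cast
          rw [ENNReal.coe_rpow_of_nonneg _ (by linarith)]; simp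
        _ ≤ A := by exact_mod_cast le_self_add
    calc (C : ℝ≥0∞) * (M * (T + M) ^ (p - 1))
        ≤ C * (((A : ℝ≥0∞)⁻¹ * T) * (2 * T) ^ (p - 1)) := by
          gcongr
          rw [two_mul]; gcongr
      _ = (C * 2 ^ (p - 1)) * (A : ℝ≥0∞)⁻¹ * T ^ p := by
          rw [ENNReal.mul_rpow_of_nonneg _ _ hp1, split T]; ring
      _ ≤ (2⁻¹ * A) * (A : ℝ≥0∞)⁻¹ * T ^ p := by gcongr
      _ = 2⁻¹ * T ^ p := by
          rw [mul_assoc 2⁻¹, ENNReal.mul_inv_cancel hA0 ENNReal.coe_ne_top, mul_one]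

/-! ### Averages over balls -/

/-- The fractional average `ρ ^ (-d) ν(B(y, ρ))` of a measure; for `d = n - α` these averages are,
up to a constant, the ones in the definition of the fractional maximal function. -/
noncomputable def ballAvg (d : ℝ) (ν : Measure (EuclideanSpace ℝ (Fin n))) (ρ : ℝ)
    (y : EuclideanSpace ℝ (Fin n)) : ℝ≥0∞ :=
  ENNReal.ofReal (ρ ^ (-d)) * ν (ball y ρ)

lemma measurable_measure_ball (ν : Measure (EuclideanSpace ℝ (Fin n))) [SFinite ν] (ρ : ℝ) :
    Measurable fun y => ν (ball y ρ) := by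
  have h : MeasurableSet {q : EuclideanSpace ℝ (Fin n) × EuclideanSpace ℝ (Fin n) |
      dist q.2 q.1 < ρ} :=
    measurableSet_lt (measurable_snd.dist measurable_fst) measurable_const
  exact measurable_measure_prodMk_left (ν := ν) h

lemma measurable_ballAvg (d : ℝ) (ν : Measure (EuclideanSpace ℝ (Fin n))) [SFinite ν] (ρ : ℝ) :
    Measurable (ballAvg d ν ρ) :=
  (measurable_measure_ball ν ρ).const_mul _

lemma ballAvg_ne_top (d : ℝ) (ν : Measure (EuclideanSpace ℝ (Fin n)))
    [IsLocallyFiniteMeasure ν] (ρ : ℝ) (y : EuclideanSpace ℝ (Fin n)) : ballAvg d ν ρ y ≠ ∞ :=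
  ENNReal.mul_ne_top ENNReal.ofReal_ne_top measure_ball_lt_top.ne

lemma ballAvg_le_of_subset {d : ℝ} (ν : Measure (EuclideanSpace ℝ (Fin n))) {ρ : ℝ} (hρ : 0 < ρ)
    {y z : EuclideanSpace ℝ (Fin n)} (h : ball y ρ ⊆ ball z (2 * ρ)) :
    ballAvg d ν ρ y ≤ ENNReal.ofReal (2 ^ d) * ballAvg d ν (2 * ρ) z := by
  rw [ballAvg, ballAvg, ← mul_assoc, ← ENNReal.ofReal_mul (by positivity),
    Real.mul_rpow (by norm_num) hρ.le, ← mul_assoc, ← Real.rpow_add (by norm_num),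
    add_neg_cancel, Real.rpow_zero, one_mul]
  gcongr

lemma ball_subset_ball_two_mul {ρ : ℝ} {y z : EuclideanSpace ℝ (Fin n)} (h : dist y z < ρ) :
    ball y ρ ⊆ ball z (2 * ρ) :=
  ball_subset_ball' (by linarith)

lemma volume_ball_eq (hn : 0 < n) (x : EuclideanSpace ℝ (Fin n)) {r : ℝ} (hr : 0 ≤ r) :
    volume (ball x r) = ENNReal.ofReal (r ^ (n : ℝ)) *
      volume (ball (0 : EuclideanSpace ℝ (Fin n)) 1) := by
  have : Nonempty (Fin n) := ⟨⟨0, hn⟩⟩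
  rw [Measure.addHaar_ball volume x hr, finrank_euclideanSpace_fin, Real.rpow_natCast]

lemma setLIntegral_measure_ball_le (ν : Measure (EuclideanSpace ℝ (Fin n))) [SFinite ν]
    (hn : 0 < n) (y : EuclideanSpace ℝ (Fin n)) (ρ : ℝ) {δ : ℝ} (hδ : 0 ≤ δ) :
    ∫⁻ z in ball y ρ, ν (ball z δ) ≤ ENNReal.ofReal (δ ^ (n : ℝ)) *
      volume (ball (0 : EuclideanSpace ℝ (Fin n)) 1) * ν (ball y (ρ + δ)) := by
  have hmeas : Measurable fun q : EuclideanSpace ℝ (Fin n) × EuclideanSpace ℝ (Fin n) =>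
      (ball q.1 δ).indicator (fun _ => (1 : ℝ≥0∞)) q.2 := by
    have h : MeasurableSet {q : EuclideanSpace ℝ (Fin n) × EuclideanSpace ℝ (Fin n) |
        dist q.2 q.1 < δ} :=
      measurableSet_lt (measurable_snd.dist measurable_fst) measurable_const
    exact measurable_const.indicator h
  calc ∫⁻ z in ball y ρ, ν (ball z δ)
      = ∫⁻ z in ball y ρ, ∫⁻ w, (ball z δ).indicator (fun _ => (1 : ℝ≥0∞)) w ∂ν := by
        simp [lintegral_indicator measurableSet_ball]
    _ = ∫⁻ w, (∫⁻ z in ball y ρ, (ball z δ).indicator (fun _ => (1 : ℝ≥0∞)) w) ∂ν :=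
        lintegral_lintegral_swap hmeas.aemeasurable
    _ ≤ ∫⁻ w, (ball y (ρ + δ)).indicator (fun _ => volume (ball w δ)) w ∂ν := by
        refine lintegral_mono fun w => ?_
        have e : ∀ z, (ball z δ).indicator (fun _ => (1 : ℝ≥0∞)) w =
            (ball w δ).indicator (fun _ => 1) z := fun z => by
          simp only [indicator, mem_ball, dist_comm]
        simp only [e]
        by_cases hw : w ∈ ball y (ρ + δ)
        · rw [indicator_of_mem hw]
          refine (setLIntegral_le_lintegral _ _).trans ?_
          simp [lintegral_indicator measurableSet_ball]
        · rw [indicator_of_notMem hw, lintegral_indicator measurableSet_ball,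
            Measure.restrict_restrict measurableSet_ball]
          have : ball w δ ∩ ball y ρ = ∅ := by
            ext z
            simp only [mem_inter_iff, mem_ball, mem_empty_iff_false, iff_false, not_and, not_lt]
              at hw ⊢
            intro h1
            have := dist_triangle_left w y z
            linarith
          simp [this]
    _ = _ := by
        simp_rw [volume_ball_eq hn _ hδ]
        rw [lintegral_indicator measurableSet_ball, setLIntegral_const]

/-- Near its centre or near its boundary alike, a ball contains a fixed proportion of each small
ball centred in it. -/
lemma exists_ball_subset_inter {x y : EuclideanSpace ℝ (Fin n)} {r s : ℝ} (hs : 0 < s)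
    (hsr : s ≤ r) (hy : y ∈ ball x r) :
    ∃ c, ball c s ⊆ ball x r ∩ ball y (4 * s) := by
  rw [mem_ball] at hy
  rcases le_or_gt (dist y x) s with h | h
  · refine ⟨x, subset_inter (ball_subset_ball hsr) (ball_subset_ball' ?_)⟩
    rw [dist_comm]; linarith
  · have hd : 0 < dist y x := hs.trans h
    have ht0 : 0 ≤ s / dist y x := by positivity
    have ht1 : s / dist y x ≤ 1 := (div_le_one hd).2 h.le
    refine ⟨AffineMap.lineMap y x (s / dist y x),
      subset_inter (ball_subset_ball' ?_) (ball_subset_ball' ?_)⟩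
    · rw [dist_lineMap_right, Real.norm_of_nonneg (by linarith), sub_mul, one_mul,
        div_mul_cancel₀ _ hd.ne']
      linarith
    · rw [dist_lineMap_left, Real.norm_of_nonneg ht0, div_mul_cancel₀ _ hd.ne']
      linarith

/-! ### Transport between nearby points -/

/-- Replaces `h` by `H` at nearby points of `G`: the mass of `h` at `y` is spread evenly over
`ball y ρ ∩ G`, which carries a fixed proportion of `μ (ball y (2 * ρ))`. -/
lemma lintegral_le_of_fat (μ : Measure (EuclideanSpace ℝ (Fin n))) [SFinite μ]
    [IsLocallyFiniteMeasure μ] [μ.IsOpenPosMeasure] {ρ : ℝ} (hρ : 0 < ρ)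
    {B G : Set (EuclideanSpace ℝ (Fin n))} (hB : MeasurableSet B)
    {h H : EuclideanSpace ℝ (Fin n) → ℝ≥0∞} (hH : Measurable H) {C : ℝ≥0∞}
    (hfat : ∀ y ∈ B, h y ≠ 0 → μ (ball y (2 * ρ)) ≤ C * μ (ball y ρ ∩ G))
    (hle : ∀ y ∈ B, ∀ z ∈ ball y ρ ∩ G, h y ≤ H z) :
    ∫⁻ y in B, h y ∂μ ≤ C * ∫⁻ z in G, H z ∂μ := by
  set Φ : EuclideanSpace ℝ (Fin n) → ℝ≥0∞ := fun z => H z * (μ (ball z ρ))⁻¹ with hΦ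
  have hΦm : Measurable Φ := hH.mul (measurable_measure_ball μ ρ).inv
  have hmeas : Measurable fun q : EuclideanSpace ℝ (Fin n) × EuclideanSpace ℝ (Fin n) =>
      (ball q.1 ρ).indicator Φ q.2 := by
    have hs : MeasurableSet {q : EuclideanSpace ℝ (Fin n) × EuclideanSpace ℝ (Fin n) |
        dist q.2 q.1 < ρ} :=
      measurableSet_lt (measurable_snd.dist measurable_fst) measurable_const
    exact (hΦm.comp measurable_snd).indicator hs
  have hpt : ∀ y ∈ B, h y ≤ C * ∫⁻ z in G, (ball y ρ).indicator Φ z ∂μ := by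
    intro y hy
    by_cases h0 : h y = 0
    · simp [h0]
    have hpos : μ (ball y (2 * ρ)) ≠ 0 := (measure_ball_pos μ y (by positivity)).ne'
    have hfin : μ (ball y (2 * ρ)) ≠ ∞ := measure_ball_lt_top.ne
    calc h y = h y * (μ (ball y (2 * ρ)) * (μ (ball y (2 * ρ)))⁻¹) := by
          rw [ENNReal.mul_inv_cancel hpos hfin, mul_one]
      _ ≤ h y * ((C * μ (ball y ρ ∩ G)) * (μ (ball y (2 * ρ)))⁻¹) := by
          gcongr; exact hfat y hy h0
      _ = C * (h y * (μ (ball y (2 * ρ)))⁻¹ * μ (ball y ρ ∩ G)) := by ring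
      _ = C * ∫⁻ z in ball y ρ ∩ G, h y * (μ (ball y (2 * ρ)))⁻¹ ∂μ := by
          rw [setLIntegral_const]
      _ ≤ C * ∫⁻ z in ball y ρ ∩ G, Φ z ∂μ := by
          gcongr C * ?_
          refine setLIntegral_mono hΦm fun z hz => ?_
          refine mul_le_mul' (hle y hy z hz) (ENNReal.inv_le_inv.2 (measure_mono ?_))
          exact ball_subset_ball_two_mul hz.1
      _ = C * ∫⁻ z in G, (ball y ρ).indicator Φ z ∂μ := by
          rw [lintegral_indicator measurableSet_ball, Measure.restrict_restrict measurableSet_ball]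
  calc ∫⁻ y in B, h y ∂μ
      ≤ ∫⁻ y in B, C * ∫⁻ z in G, (ball y ρ).indicator Φ z ∂μ ∂μ :=
        setLIntegral_mono' hB hpt
    _ = C * ∫⁻ y in B, ∫⁻ z in G, (ball y ρ).indicator Φ z ∂μ ∂μ :=
        lintegral_const_mul _ (Measurable.lintegral_prod_right' hmeas)
    _ = C * ∫⁻ z in G, ∫⁻ y in B, (ball y ρ).indicator Φ z ∂μ ∂μ := by
        rw [lintegral_lintegral_swap hmeas.aemeasurable]
    _ ≤ C * ∫⁻ z in G, H z ∂μ := by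
        gcongr C * ?_
        refine lintegral_mono fun z => ?_
        have e : ∀ y, (ball y ρ).indicator Φ z = (ball z ρ).indicator (fun _ => Φ z) y :=
          fun y => by simp only [indicator, mem_ball, dist_comm]
        simp only [e]
        refine (setLIntegral_le_lintegral _ _).trans ?_
        rw [lintegral_indicator measurableSet_ball, setLIntegral_const, hΦ, mul_assoc,
          ENNReal.inv_mul_cancel (measure_ball_pos μ z hρ).ne' measure_ball_lt_top.ne, mul_one]

/-! ### Muckenhoupt weights -/

/-- The only consequence of the Muckenhoupt condition that is needed: a subset of a ball that
carries a fixed proportion of its volume carries a fixed proportion of its `μ`-measure. -/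
def FatSets (μ : Measure (EuclideanSpace ℝ (Fin n))) : Prop :=
  ∀ θ : ℝ≥0, ∃ C : ℝ≥0, ∀ (x : EuclideanSpace ℝ (Fin n)) (r : ℝ), 0 < r →
    ∀ S ⊆ ball x r, MeasurableSet S → volume (ball x r) ≤ θ * volume S → μ (ball x r) ≤ C * μ S

lemma ball_subset_cube (x : EuclideanSpace ℝ (Fin n)) (r : ℝ) : ball x r ⊆ cube x r := by
  intro y hy i
  rw [mem_ball, dist_eq_norm] at hy
  have := PiLp.norm_apply_le (y - x) i
  rw [PiLp.sub_apply, Real.norm_eq_abs] at this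
  exact this.trans_lt hy

lemma cube_subset_ball (x : EuclideanSpace ℝ (Fin n)) {r : ℝ} (hr : 0 < r) :
    cube x r ⊆ ball x ((n + 1) * r) := by
  intro y hy
  rw [mem_ball, EuclideanSpace.dist_eq, Real.sqrt_lt' (by positivity)]
  calc ∑ i, dist (y i) (x i) ^ 2 ≤ ∑ _i : Fin n, r ^ 2 := by
        refine Finset.sum_le_sum fun i _ => ?_
        rw [Real.dist_eq]
        exact pow_le_pow_left₀ (abs_nonneg _) (hy i).le 2
    _ = n * r ^ 2 := by simp
    _ < ((n + 1) * r) ^ 2 := by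
        have : 0 < r ^ 2 := by positivity
        nlinarith [(Nat.cast_nonneg n : (0 : ℝ) ≤ n)]

lemma volume_cube_le (hn : 0 < n) (x : EuclideanSpace ℝ (Fin n)) {r : ℝ} (hr : 0 < r) :
    volume (cube x r) ≤ ((n + 1 : ℝ≥0) ^ n : ℝ≥0) * volume (ball x r) := by
  refine (measure_mono (cube_subset_ball x hr)).trans ?_
  rw [volume_ball_eq hn x hr.le, volume_ball_eq hn x (by positivity),
    Real.mul_rpow (by positivity) hr.le, ENNReal.ofReal_mul (by positivity), ← mul_assoc]
  gcongr
  rw [Real.rpow_natCast, ENNReal.ofReal_pow (by positivity)]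
  push_cast
  rw [ENNReal.ofReal_add (by positivity) (by positivity)]
  simp

lemma wMeas_eq_withDensity (v : EuclideanSpace ℝ (Fin n) → ℝ) (S : Set (EuclideanSpace ℝ (Fin n))) :
    wMeas v S = volume.withDensity (fun x => ENNReal.ofReal (v x)) S :=
  (withDensity_apply' _ _).symm

lemma isLocallyFiniteMeasure_withDensity {f : EuclideanSpace ℝ (Fin n) → ℝ}
    (hf : LocallyIntegrable f volume) :
    IsLocallyFiniteMeasure
      ((volume : Measure (EuclideanSpace ℝ (Fin n))).withDensity
        fun x => ENNReal.ofReal (f x)) := by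
  refine ⟨fun x => ?_⟩
  obtain ⟨U, hU, hfU⟩ := hf x
  refine ⟨U, hU, ?_⟩
  rw [withDensity_apply']
  exact (lintegral_mono fun y => Real.ofReal_le_enorm (f y)).trans_lt hfU.2

lemma IsWeight.isOpenPosMeasure {v : EuclideanSpace ℝ (Fin n) → ℝ} (hv : IsWeight v) :
    ((volume : Measure (EuclideanSpace ℝ (Fin n))).withDensity
      fun x => ENNReal.ofReal (v x)).IsOpenPosMeasure := by
  refine (withDensity_absolutelyContinuous' ?_ ?_).isOpenPosMeasure
  · exact hv.1.aestronglyMeasurable.aemeasurable.ennreal_ofReal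
  · filter_upwards [hv.2] with x hx
    simpa using hx

lemma fatSets_of_cube (hn : 0 < n) {v : EuclideanSpace ℝ (Fin n) → ℝ}
    (h : ∀ θ : ℝ≥0, ∃ C : ℝ≥0, ∀ (x : EuclideanSpace ℝ (Fin n)) (r : ℝ), 0 < r →
      ∀ S ⊆ cube x r, MeasurableSet S → volume S ≠ 0 → volume (cube x r) ≤ θ * volume S →
        wMeas v (cube x r) ≤ C * wMeas v S) :
    FatSets ((volume : Measure (EuclideanSpace ℝ (Fin n))).withDensity
      fun x => ENNReal.ofReal (v x)) := by
  intro θ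
  obtain ⟨C, hC⟩ := h ((n + 1 : ℝ≥0) ^ n * θ)
  refine ⟨C, fun x r hr S hS hSm hθ => ?_⟩
  rw [← wMeas_eq_withDensity, ← wMeas_eq_withDensity]
  have h0 : volume S ≠ 0 := fun h0 => by
    rw [h0, mul_zero] at hθ
    exact (measure_ball_pos volume x hr).not_ge hθ
  refine le_trans ?_ (hC x r hr S (hS.trans (ball_subset_cube x r)) hSm h0 ?_)
  · exact lintegral_mono_set (ball_subset_cube x r)
  · refine (volume_cube_le hn x hr).trans ?_
    rw [ENNReal.coe_mul, mul_assoc]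
    gcongr

lemma volume_cube_ne_top (x : EuclideanSpace ℝ (Fin n)) {r : ℝ} (hr : 0 < r) :
    volume (cube x r) ≠ ∞ :=
  ((measure_mono (cube_subset_ball x hr)).trans_lt measure_ball_lt_top).ne

lemma wMeas_cube_ne_zero {v : EuclideanSpace ℝ (Fin n) → ℝ} (hv : IsWeight v)
    (x : EuclideanSpace ℝ (Fin n)) {r : ℝ} (hr : 0 < r) : wMeas v (cube x r) ≠ 0 := by
  rw [wMeas_eq_withDensity]
  have := hv.isOpenPosMeasure
  exact ((measure_ball_pos _ x hr).trans_le (measure_mono (ball_subset_cube x r))).ne'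

lemma MuckenhouptAOne.fatSets (hn : 0 < n) {v : EuclideanSpace ℝ (Fin n) → ℝ}
    (hv : MuckenhouptAOne v) :
    FatSets ((volume : Measure (EuclideanSpace ℝ (Fin n))).withDensity
      fun x => ENNReal.ofReal (v x)) := by
  obtain ⟨hw, A, hA⟩ := hv
  refine fatSets_of_cube hn fun θ => ⟨A * θ, fun x r hr S hS hSm h0 hθ => ?_⟩
  set e := essInf (fun y => ENNReal.ofReal (v y)) (volume.restrict (cube x r)) with he
  have hQ0 : volume (cube x r) ≠ 0 := fun h => h0 (measure_mono_null hS h)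
  have h1 : e * volume S ≤ wMeas v S := by
    rw [wMeas, ← setLIntegral_const]
    refine lintegral_mono_ae ?_
    exact ae_mono (Measure.restrict_mono hS le_rfl) ae_essInf_le
  calc wMeas v (cube x r)
      = wMeas v (cube x r) / volume (cube x r) * volume (cube x r) :=
        (ENNReal.div_mul_cancel hQ0 (volume_cube_ne_top x hr)).symm
    _ ≤ A * e * (θ * volume S) := mul_le_mul' (hA x r hr) hθ
    _ = (A * θ : ℝ≥0) * (e * volume S) := by push_cast; ring
    _ ≤ _ := by gcongr

/-- Hölder's inequality for `1 = w ^ (1 / q) * w ^ (-1 / q)`. -/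
lemma volume_rpow_le_of_isWeight {v : EuclideanSpace ℝ (Fin n) → ℝ} (hv : IsWeight v) {q : ℝ}
    (hq : 1 < q) (S : Set (EuclideanSpace ℝ (Fin n))) :
    volume S ^ q ≤ wMeas v S *
      (∫⁻ y in S, ENNReal.ofReal (v y) ^ (1 - Real.conjExponent q)) ^ (q - 1) := by
  have hq0 : 0 < q := by linarith
  have hconj := Real.HolderConjugate.conjExponent hq
  set q' := Real.conjExponent q with hq'
  have hq'0 : 0 < q' := hconj.symm.pos
  have hm : AEMeasurable (fun y => ENNReal.ofReal (v y)) (volume.restrict S) :=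
    hv.1.aestronglyMeasurable.aemeasurable.ennreal_ofReal.restrict
  have hexp : -(1 / q) * q' = 1 - q' := by
    have := hconj.mul_eq_add
    field_simp
    linarith
  have hholder := ENNReal.lintegral_mul_le_Lp_mul_Lq (volume.restrict S) hconj
    (hm.pow_const (1 / q)) (hm.pow_const (-(1 / q)))
  have hone : ∫⁻ y in S, ((fun y => ENNReal.ofReal (v y) ^ (1 / q)) *
      fun y => ENNReal.ofReal (v y) ^ (-(1 / q))) y = volume S := by
    rw [← setLIntegral_one]
    refine lintegral_congr_ae ?_
    filter_upwards [ae_restrict_of_ae hv.2] with y hy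
    rw [Pi.mul_apply, ← ENNReal.rpow_add _ _ (by simpa using hy) ENNReal.ofReal_ne_top,
      add_neg_cancel, ENNReal.rpow_zero]
  rw [hone] at hholder
  simp only [← ENNReal.rpow_mul, one_div_mul_cancel hq0.ne', ENNReal.rpow_one, hexp] at hholder
  calc volume S ^ q ≤ _ := ENNReal.rpow_le_rpow hholder hq0.le
    _ = _ := by
      rw [ENNReal.mul_rpow_of_nonneg _ _ hq0.le, ← ENNReal.rpow_mul, ← ENNReal.rpow_mul,
        one_div_mul_cancel hq0.ne', ENNReal.rpow_one, wMeas]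
      congr 2
      have := hconj.mul_eq_add
      field_simp
      linarith

lemma MuckenhouptA.fatSets (hn : 0 < n) {v : EuclideanSpace ℝ (Fin n) → ℝ} {q : ℝ} (hq : 1 < q)
    (hv : MuckenhouptA q v) :
    FatSets ((volume : Measure (EuclideanSpace ℝ (Fin n))).withDensity
      fun x => ENNReal.ofReal (v x)) := by
  obtain ⟨hw, A, hA⟩ := hv
  have hq0 : 0 < q := by linarith
  refine fatSets_of_cube hn fun θ => ⟨A * θ ^ q, fun x r hr S hS hSm h0 hθ => ?_⟩
  set σ := (∫⁻ y in cube x r, ENNReal.ofReal (v y) ^ (1 - Real.conjExponent q)) ^ (q - 1) with hσ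
  have hSσ : volume S ^ q ≤ wMeas v S * σ := by
    refine (volume_rpow_le_of_isWeight hw hq S).trans ?_
    exact mul_le_mul_right (ENNReal.rpow_le_rpow (lintegral_mono_set hS) (by linarith)) _
  have hSfin : volume S ≠ ∞ := ((measure_mono hS).trans_lt (volume_cube_ne_top x hr).lt_top).ne
  have hσ0 : σ ≠ 0 := fun h => by
    rw [h, mul_zero, nonpos_iff_eq_zero, ENNReal.rpow_eq_zero_iff] at hSσ
    rcases hSσ with h' | h'
    · exact h0 h'.1
    · linarith [h'.2]
  have hσt : σ ≠ ∞ := fun h => by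
    have h1 := hA x r hr
    rw [← hσ, h, ENNReal.mul_top (wMeas_cube_ne_zero hw x hr), top_le_iff] at h1
    exact ENNReal.mul_ne_top ENNReal.coe_ne_top
      (ENNReal.rpow_ne_top_of_nonneg hq0.le (volume_cube_ne_top x hr)) h1
  rw [← ENNReal.mul_le_mul_iff_left hσ0 hσt]
  calc wMeas v (cube x r) * σ ≤ A * volume (cube x r) ^ q := hA x r hr
    _ ≤ A * (θ * volume S) ^ q := by gcongr
    _ = (A * θ ^ q : ℝ≥0) * volume S ^ q := by
        rw [ENNReal.mul_rpow_of_nonneg _ _ hq0.le]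
        push_cast
        rw [ENNReal.coe_rpow_of_nonneg _ hq0.le]
        ring
    _ ≤ (A * θ ^ q : ℝ≥0) * (wMeas v S * σ) := by gcongr
    _ = _ := by ring

lemma MuckenhouptAInfty.isWeight {v : EuclideanSpace ℝ (Fin n) → ℝ} (hv : MuckenhouptAInfty v) :
    IsWeight v := by
  rcases hv with h | ⟨q, _, h⟩
  · exact h.1
  · exact h.1

lemma MuckenhouptAInfty.fatSets (hn : 0 < n) {v : EuclideanSpace ℝ (Fin n) → ℝ}
    (hv : MuckenhouptAInfty v) :
    FatSets ((volume : Measure (EuclideanSpace ℝ (Fin n))).withDensity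
      fun x => ENNReal.ofReal (v x)) := by
  rcases hv with h | ⟨q, hq, h⟩
  · exact h.fatSets hn
  · exact h.fatSets hn hq

/-! ### Local comparison of sums and suprema of averages -/

lemma volume_ball_mul (hn : 0 < n) (y c : EuclideanSpace ℝ (Fin n)) {t s : ℝ} (ht : 0 ≤ t)
    (hs : 0 ≤ s) :
    volume (ball y (t * s)) = ENNReal.ofReal (t ^ (n : ℝ)) * volume (ball c s) := by
  rw [volume_ball_eq hn y (by positivity), volume_ball_eq hn c hs, Real.mul_rpow ht hs,
    ENNReal.ofReal_mul (by positivity), mul_assoc]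

lemma setLIntegral_ballAvg_le (hn : 0 < n) (d : ℝ) (ν : Measure (EuclideanSpace ℝ (Fin n)))
    [SFinite ν] (y : EuclideanSpace ℝ (Fin n)) {ρ : ℝ} (hρ : 0 < ρ) (i : ℕ) :
    ∫⁻ z in ball y ρ, ballAvg d ν (ρ / 2 ^ i) z ≤
      ENNReal.ofReal (2 ^ (-(n - d))) ^ i * (ENNReal.ofReal (2 ^ d) * volume (ball y ρ) *
        ballAvg d ν (2 * ρ) y) := by
  set δ := ρ / 2 ^ i with hδ
  have hδ0 : 0 < δ := by positivity
  have hδρ : δ ≤ ρ := div_le_self hρ.le (one_le_pow₀ (by norm_num))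
  have hreal : δ ^ (-d) * δ ^ (n : ℝ) =
      (2 ^ (-(n - d))) ^ i * (2 ^ d * ρ ^ (n : ℝ) * (2 * ρ) ^ (-d)) := by
    have h2 : (2 * ρ) ^ (-d) = 2 ^ (-d) * ρ ^ (-d) := Real.mul_rpow (by norm_num) hρ.le
    have h3 : (2 : ℝ) ^ d * 2 ^ (-d) = 1 := by
      rw [← Real.rpow_add (by norm_num), add_neg_cancel, Real.rpow_zero]
    have h4 : ((2 : ℝ) ^ (-(n - d))) ^ i = (2 ^ i) ^ (-(n - d)) := by
      rw [← Real.rpow_natCast, ← Real.rpow_mul (by norm_num), mul_comm, Real.rpow_mul (by norm_num),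
        Real.rpow_natCast]
    rw [← Real.rpow_add hδ0, hδ, Real.div_rpow hρ.le (by positivity), h2, h4,
      show -d + (n : ℝ) = n - d by ring, Real.rpow_neg (by positivity)]
    calc _ = ((2 ^ i) ^ ((n : ℝ) - d))⁻¹ * (ρ ^ (n : ℝ) * ρ ^ (-d)) := by
          rw [← Real.rpow_add hρ, ← sub_eq_add_neg]; field_simp
      _ = ((2 ^ i) ^ ((n : ℝ) - d))⁻¹ * ((2 ^ d * 2 ^ (-d)) * (ρ ^ (n : ℝ) * ρ ^ (-d))) := by
          rw [h3, one_mul]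
      _ = _ := by ring
  calc ∫⁻ z in ball y ρ, ballAvg d ν δ z
      = ENNReal.ofReal (δ ^ (-d)) * ∫⁻ z in ball y ρ, ν (ball z δ) :=
        lintegral_const_mul _ (measurable_measure_ball ν δ)
    _ ≤ ENNReal.ofReal (δ ^ (-d)) * (ENNReal.ofReal (δ ^ (n : ℝ)) *
        volume (ball (0 : EuclideanSpace ℝ (Fin n)) 1) * ν (ball y (ρ + δ))) := by
        gcongr; exact setLIntegral_measure_ball_le ν hn y ρ hδ0.le
    _ ≤ ENNReal.ofReal (δ ^ (-d)) * (ENNReal.ofReal (δ ^ (n : ℝ)) *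
        volume (ball (0 : EuclideanSpace ℝ (Fin n)) 1) * ν (ball y (2 * ρ))) := by
        gcongr; linarith
    _ = ENNReal.ofReal (δ ^ (-d) * δ ^ (n : ℝ)) *
        volume (ball (0 : EuclideanSpace ℝ (Fin n)) 1) * ν (ball y (2 * ρ)) := by
        rw [ENNReal.ofReal_mul (by positivity)]; ring
    _ = _ := by
        rw [hreal, ballAvg, volume_ball_eq hn y hρ.le, ENNReal.ofReal_mul (by positivity),
          ENNReal.ofReal_mul (by positivity), ENNReal.ofReal_mul (by positivity),
          ENNReal.ofReal_pow (by positivity)]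
        ring

/-- On average over `ball y ρ`, the mean at scale `ρ / 2 ^ i` decays geometrically in `i`. So, for
large `m`, the scales below `ρ / 2 ^ m` together are dominated by the scale `4 * ρ` outside a set of
small volume. -/
lemma exists_volume_tail_le {d : ℝ} (hd : d < n) (hn : 0 < n) {ε : ℝ≥0∞} (hε : ε ≠ 0) :
    ∃ m : ℕ, ∀ (ν : Measure (EuclideanSpace ℝ (Fin n))) [IsLocallyFiniteMeasure ν] [SFinite ν]
      (y : EuclideanSpace ℝ (Fin n)) (ρ : ℝ) (K : ℕ), 0 < ρ → ballAvg d ν (2 * ρ) y ≠ 0 →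
      volume {z ∈ ball y ρ | ballAvg d ν (4 * ρ) z <
        ∑ j ∈ Finset.range K, ballAvg d ν (ρ / 2 ^ (m + j)) z} ≤ ε * volume (ball y ρ) := by
  set c : ℝ≥0∞ := ENNReal.ofReal (2 ^ (-(n - d))) with hc
  set D : ℝ≥0∞ := ENNReal.ofReal (2 ^ d) with hD
  have hc1 : c < 1 := by
    rw [hc, ENNReal.ofReal_lt_one]
    exact Real.rpow_lt_one_of_one_lt_of_neg (by norm_num) (by linarith)
  obtain ⟨m, hm⟩ : ∃ m : ℕ, c ^ m * ((1 - c)⁻¹ * (D * D)) ≤ ε := by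
    have hfin : (1 - c)⁻¹ * (D * D) ≠ ∞ := by
      refine ENNReal.mul_ne_top (ENNReal.inv_ne_top.2 (tsub_pos_of_lt hc1).ne') ?_
      exact ENNReal.mul_ne_top ENNReal.ofReal_ne_top ENNReal.ofReal_ne_top
    have ht := ENNReal.Tendsto.mul_const (b := (1 - c)⁻¹ * (D * D))
      (ENNReal.tendsto_pow_atTop_nhds_zero_of_lt_one hc1) (Or.inr hfin)
    rw [zero_mul] at ht
    obtain ⟨m, hm⟩ := (ht.eventually (ge_mem_nhds (pos_iff_ne_zero.2 hε))).exists
    exact ⟨m, hm⟩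
  refine ⟨m, fun ν _ _ y ρ K hρ h0 => ?_⟩
  set A := ballAvg d ν (2 * ρ) y with hA
  have hAt : A ≠ ∞ := ballAvg_ne_top _ _ _ _
  set F : EuclideanSpace ℝ (Fin n) → ℝ≥0∞ :=
    fun z => ∑ j ∈ Finset.range K, ballAvg d ν (ρ / 2 ^ (m + j)) z with hF
  have hFm : Measurable F := Finset.measurable_sum _ fun j _ => measurable_ballAvg d ν _
  have hint : ∫⁻ z in ball y ρ, F z ≤ c ^ m * (1 - c)⁻¹ * (D * volume (ball y ρ) * A) := by
    rw [hF, lintegral_finsetSum _ fun j _ => measurable_ballAvg d ν _]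
    calc _ ≤ ∑ j ∈ Finset.range K, c ^ (m + j) * (D * volume (ball y ρ) * A) :=
          Finset.sum_le_sum fun j _ => setLIntegral_ballAvg_le hn d ν y hρ (m + j)
      _ = c ^ m * (∑ j ∈ Finset.range K, c ^ j) * (D * volume (ball y ρ) * A) := by
          simp_rw [pow_add, ← Finset.sum_mul, ← Finset.mul_sum]
      _ ≤ _ := by
          gcongr
          rw [← ENNReal.tsum_geometric]
          exact ENNReal.sum_le_tsum _
  have hsub : {z ∈ ball y ρ | ballAvg d ν (4 * ρ) z < F z} ⊆
      {z | A ≤ D * F z} ∩ ball y ρ := by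
    rintro z ⟨hz, hlt⟩
    refine ⟨?_, hz⟩
    have h1 : ball y (2 * ρ) ⊆ ball z (2 * (2 * ρ)) := by
      refine ball_subset_ball_two_mul ?_
      rw [mem_ball, dist_comm] at hz
      linarith
    have h2 := ballAvg_le_of_subset (d := d) ν (by positivity) h1
    rw [show 2 * (2 * ρ) = 4 * ρ by ring] at h2
    exact h2.trans (mul_le_mul_right hlt.le _)
  have hmark := mul_meas_ge_le_lintegral₀ (μ := volume.restrict (ball y ρ))
    (hFm.const_mul D).aemeasurable A
  rw [Measure.restrict_apply (measurableSet_le measurable_const (hFm.const_mul D)),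
    lintegral_const_mul _ hFm] at hmark
  rw [← ENNReal.mul_le_mul_iff_right h0 hAt]
  calc A * volume {z ∈ ball y ρ | ballAvg d ν (4 * ρ) z < F z}
      ≤ A * volume ({z | A ≤ D * F z} ∩ ball y ρ) := by gcongr
    _ ≤ D * ∫⁻ z in ball y ρ, F z := hmark
    _ ≤ D * (c ^ m * (1 - c)⁻¹ * (D * volume (ball y ρ) * A)) := by gcongr
    _ = A * ((c ^ m * ((1 - c)⁻¹ * (D * D))) * volume (ball y ρ)) := by ring
    _ ≤ A * (ε * volume (ball y ρ)) := by gcongr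

/-- The points where the tail of small scales is dominated by the scale `4 * ρ` carry, within
`ball x r` and close to any `y ∈ ball x r`, a fixed proportion of the `μ`-measure. -/
lemma exists_measure_ball_le_good {d : ℝ} (hd : d < n) (hn : 0 < n)
    {μ : Measure (EuclideanSpace ℝ (Fin n))} (hμ : FatSets μ) :
    ∃ (m : ℕ) (C : ℝ≥0), ∀ (ν : Measure (EuclideanSpace ℝ (Fin n))) [IsLocallyFiniteMeasure ν]
      [SFinite ν] (x y : EuclideanSpace ℝ (Fin n)) (r ρ : ℝ) (K : ℕ), 0 < ρ → ρ ≤ 4 * r →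
      y ∈ ball x r → ballAvg d ν (2 * ρ) y ≠ 0 →
      μ (ball y (2 * ρ)) ≤ C * μ (ball y ρ ∩ (ball x r ∩
        {z | ∑ j ∈ Finset.range K, ballAvg d ν (ρ / 2 ^ (m + j)) z ≤ ballAvg d ν (4 * ρ) z})) := by
  -- `q` is the ratio of the volumes of balls of radii `ρ` and `ρ / 4`; the bad set gets at most
  -- half of the volume of the smaller one
  set q : ℝ≥0∞ := ENNReal.ofReal (4 ^ (n : ℝ)) with hq
  have hq0 : q ≠ 0 := by simp only [hq, ne_eq, ENNReal.ofReal_eq_zero, not_le]; positivity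
  obtain ⟨m, hm⟩ := exists_volume_tail_le (ε := 2⁻¹ * q⁻¹) hd hn
    (mul_ne_zero (by simp) (ENNReal.inv_ne_zero.2 ENNReal.ofReal_ne_top))
  obtain ⟨C, hC⟩ := hμ (((8 : ℝ) ^ (n : ℝ)).toNNReal * 2)
  refine ⟨m, C, fun ν _ _ x y r ρ K hρ hρr hy h0 => ?_⟩
  set G := {z | ∑ j ∈ Finset.range K, ballAvg d ν (ρ / 2 ^ (m + j)) z ≤ ballAvg d ν (4 * ρ) z}
    with hG
  have hGm : MeasurableSet G := measurableSet_le
    (Finset.measurable_sum _ fun j _ => measurable_ballAvg d ν _) (measurable_ballAvg d ν _)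
  refine hC y (2 * ρ) (by positivity) _
    (inter_subset_left.trans (ball_subset_ball (by linarith)))
    (measurableSet_ball.inter (measurableSet_ball.inter hGm)) ?_
  obtain ⟨c, hc⟩ := exists_ball_subset_inter (s := ρ / 4) (by positivity) (by linarith) hy
  rw [show 4 * (ρ / 4) = ρ by ring] at hc
  set S := ball y ρ ∩ (ball x r ∩ G) with hS
  set b := volume (ball c (ρ / 4)) with hb
  have hbt : b ≠ ∞ := measure_ball_lt_top.ne
  have hb_le : b ≤ volume S + 2⁻¹ * b := by
    have hcover : ball c (ρ / 4) ⊆ S ∪ {z ∈ ball y ρ | ballAvg d ν (4 * ρ) z <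
        ∑ j ∈ Finset.range K, ballAvg d ν (ρ / 2 ^ (m + j)) z} := by
      intro z hz
      rcases le_or_gt (∑ j ∈ Finset.range K, ballAvg d ν (ρ / 2 ^ (m + j)) z)
        (ballAvg d ν (4 * ρ) z) with h | h
      · exact Or.inl ⟨(hc hz).2, (hc hz).1, h⟩
      · exact Or.inr ⟨(hc hz).2, h⟩
    refine (measure_mono hcover).trans ((measure_union_le _ _).trans ?_)
    gcongr
    refine (hm ν y ρ K hρ h0).trans ?_
    have : volume (ball y ρ) = q * b := by
      rw [hb, ← volume_ball_mul hn y c (by norm_num) (by positivity)]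
      congr 2; ring
    rw [this, mul_assoc, ← mul_assoc q⁻¹, ENNReal.inv_mul_cancel hq0 ENNReal.ofReal_ne_top, one_mul]
  have hb2 : b ≤ 2 * volume S := by
    have h1 : 2⁻¹ * b + 2⁻¹ * b ≤ volume S + 2⁻¹ * b := by
      rw [← add_mul, ENNReal.inv_two_add_inv_two, one_mul]; exact hb_le
    have h2 : 2⁻¹ * b ≤ volume S :=
      (ENNReal.add_le_add_iff_right (ENNReal.mul_ne_top (by simp) hbt)).1 h1
    calc b = 2 * (2⁻¹ * b) := by
          rw [← mul_assoc, ENNReal.mul_inv_cancel (by simp) (by simp), one_mul]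
      _ ≤ _ := by gcongr
  calc volume (ball y (2 * ρ)) = ENNReal.ofReal (8 ^ (n : ℝ)) * b := by
        rw [hb, ← volume_ball_mul hn y c (by norm_num) (by positivity)]
        congr 2; ring
    _ ≤ ENNReal.ofReal (8 ^ (n : ℝ)) * (2 * volume S) := by gcongr
    _ = _ := by rw [ENNReal.coe_mul, mul_assoc]; rfl

lemma ballAvg_dyadic_le {d : ℝ} (ν : Measure (EuclideanSpace ℝ (Fin n))) {R : ℝ} (hR : 0 < R)
    (k : ℕ) {y z : EuclideanSpace ℝ (Fin n)} (h : dist y z < R / 2 ^ (k + 1)) :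
    ballAvg d ν (R / 2 ^ (k + 1)) y ≤ ENNReal.ofReal (2 ^ d) * ballAvg d ν (R / 2 ^ k) z := by
  have := ballAvg_le_of_subset (d := d) ν (by positivity) (ball_subset_ball_two_mul h)
  rwa [show 2 * (R / 2 ^ (k + 1)) = R / 2 ^ k by rw [pow_succ]; field_simp] at this

lemma setLIntegral_sum_ballAvg_rpow_lt_top {p : ℝ} (hp : 0 ≤ p) (d : ℝ)
    (μ ν : Measure (EuclideanSpace ℝ (Fin n))) [IsLocallyFiniteMeasure μ]
    [IsLocallyFiniteMeasure ν] (x : EuclideanSpace ℝ (Fin n)) (r : ℝ) (s : Finset ℕ) (ρ : ℕ → ℝ) :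
    ∫⁻ y in ball x r, (∑ k ∈ s, ballAvg d ν (ρ k) y) ^ p ∂μ < ∞ := by
  set b : ℝ≥0∞ := ∑ k ∈ s, ENNReal.ofReal (ρ k ^ (-d)) * ν (ball x (ρ k + r)) with hb
  have hbt : b ≠ ∞ := ENNReal.sum_ne_top.2 fun k _ =>
    ENNReal.mul_ne_top ENNReal.ofReal_ne_top measure_ball_lt_top.ne
  calc ∫⁻ y in ball x r, (∑ k ∈ s, ballAvg d ν (ρ k) y) ^ p ∂μ
      ≤ ∫⁻ _y in ball x r, b ^ p ∂μ := by
        refine setLIntegral_mono' measurableSet_ball fun y hy => ?_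
        refine ENNReal.rpow_le_rpow (Finset.sum_le_sum fun k _ => ?_) hp
        refine mul_le_mul_right (measure_mono (ball_subset_ball' ?_)) _
        rw [mem_ball] at hy
        linarith
    _ = b ^ p * μ (ball x r) := by rw [setLIntegral_const]
    _ < ∞ := ENNReal.mul_lt_top (ENNReal.rpow_lt_top_of_nonneg hp hbt) measure_ball_lt_top

/-- The core of the comparison, on an arbitrary ball and with the same ball on both sides: in
`L ^ p (μ)`, the sum of the averages over all scales is controlled by their supremum. -/
theorem exists_setLIntegral_sum_rpow_le {p d : ℝ} (hp : 1 < p) (hd0 : 0 < d) (hd : d < n)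
    {μ : Measure (EuclideanSpace ℝ (Fin n))} [SFinite μ] [IsLocallyFiniteMeasure μ]
    [μ.IsOpenPosMeasure] (hμ : FatSets μ) :
    ∃ C : ℝ≥0, ∀ (ν : Measure (EuclideanSpace ℝ (Fin n))) [IsLocallyFiniteMeasure ν]
      [SFinite ν] (x : EuclideanSpace ℝ (Fin n)) (r : ℝ) (K : ℕ), 0 < r →
      ∫⁻ y in ball x r, (∑ k ∈ Finset.range K, ballAvg d ν (16 * r / 2 ^ (k + 2)) y) ^ p ∂μ ≤
        C * ∫⁻ y in ball x r, (⨆ k : ℕ, ballAvg d ν (16 * r / 2 ^ k) y) ^ p ∂μ := by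
  have hn : 0 < n := by exact_mod_cast hd0.trans hd
  have hp1 : 0 ≤ p - 1 := by linarith
  obtain ⟨m, C₁, hfat⟩ := exists_measure_ball_le_good hd hn hμ
  set D : ℝ≥0∞ := ENNReal.ofReal (2 ^ d) with hD
  have hDt : D ≠ ∞ := ENNReal.ofReal_ne_top
  set C₂ : ℝ≥0∞ := ENNReal.ofReal p * (C₁ * (D * D * D ^ (p - 1) * ((m + 2 : ℕ) + 1))) with hC₂
  have hC₂t : C₂ ≠ ∞ := by
    have h1 : D ^ (p - 1) ≠ ∞ := ENNReal.rpow_ne_top_of_nonneg hp1 hDt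
    finiteness
  obtain ⟨C', hC'⟩ := exists_mul_rpow_le hp C₂.toNNReal
  rw [ENNReal.coe_toNNReal hC₂t] at hC'
  refine ⟨2 * C', fun ν _ _ x r K hr => ?_⟩
  set R : ℝ := 16 * r with hR
  have hR0 : 0 < R := by positivity
  set a : ℕ → EuclideanSpace ℝ (Fin n) → ℝ≥0∞ := fun k => ballAvg d ν (R / 2 ^ k) with ha
  have ham : ∀ k, Measurable (a k) := fun k => measurable_ballAvg d ν _
  have hat : ∀ k y, a k y ≠ ∞ := fun k y => ballAvg_ne_top d ν _ y
  have hshift : ∀ k y z, dist y z < R / 2 ^ (k + 1) → a (k + 1) y ≤ D * a k z :=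
    fun k y z h => ballAvg_dyadic_le ν hR0 k h
  set T : EuclideanSpace ℝ (Fin n) → ℝ≥0∞ := fun y => ∑ k ∈ Finset.range K, a (k + 2) y with hT
  set M : EuclideanSpace ℝ (Fin n) → ℝ≥0∞ := fun y => ⨆ k, a k y with hM
  have hTm : Measurable T := Finset.measurable_sum _ fun k _ => ham _
  have hMm : Measurable M := Measurable.iSup ham
  have haM : ∀ k y, a k y ≤ M y := fun k y => le_iSup (fun k => a k y) k
  set S : ℕ → EuclideanSpace ℝ (Fin n) → ℝ≥0∞ :=
    fun k y => ∑ i ∈ Finset.range (k + 1), a (i + 2) y with hS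
  have hSm : ∀ k, Measurable (S k) := fun k => Finset.measurable_sum _ fun k _ => ham _
  set G : ℕ → Set (EuclideanSpace ℝ (Fin n)) :=
    fun k => {z | ∑ j ∈ Finset.range K, a (k + (m + 2) + j) z ≤ a k z} with hG
  have hGm : ∀ k, MeasurableSet (G k) := fun k =>
    measurableSet_le (Finset.measurable_sum _ fun j _ => ham _) (ham k)
  set H : ℕ → EuclideanSpace ℝ (Fin n) → ℝ≥0∞ :=
    fun k z => D * D * D ^ (p - 1) * (T z + M z) ^ (p - 1) * a k z with hH
  have hHm : ∀ k, Measurable (H k) := fun k =>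
    (((hTm.add hMm).pow_const _).const_mul _).mul (ham k)
  -- each scale is transported to the points of `G k`
  have hscale : ∀ k < K, ∫⁻ y in ball x r, a (k + 2) y * S k y ^ (p - 1) ∂μ ≤
      C₁ * ∫⁻ z in ball x r, (G k).indicator (H k) z ∂μ := by
    intro k hk
    have hρ0 : 0 < R / 2 ^ (k + 2) := by positivity
    have e1 : ∀ j, R / 2 ^ (k + 2) / 2 ^ (m + j) = R / 2 ^ (k + (m + 2) + j) := fun j => by
      rw [div_div, ← pow_add]; congr 2; ring
    have e2 : 4 * (R / 2 ^ (k + 2)) = R / 2 ^ k := by rw [pow_add]; field_simp; norm_num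
    have e3 : 2 * (R / 2 ^ (k + 2)) = R / 2 ^ (k + 1) := by rw [pow_succ _ (k + 1)]; field_simp
    rw [lintegral_indicator (hGm k), Measure.restrict_restrict (hGm k), inter_comm]
    refine lintegral_le_of_fat μ hρ0 measurableSet_ball (hHm k) ?_ ?_
    · intro y hy h0
      have h1 : a (k + 1) y ≠ 0 := fun h => by
        have := hshift (k + 1) y y (by rw [dist_self]; positivity)
        rw [h, mul_zero, nonpos_iff_eq_zero] at this
        exact h0 (by rw [this, zero_mul])
      have hle : R / 2 ^ (k + 2) ≤ 4 * r := by
        rw [div_le_iff₀ (by positivity), hR, pow_add]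
        have : (1 : ℝ) ≤ 2 ^ k := one_le_pow₀ (by norm_num)
        nlinarith
      have := hfat ν x y r (R / 2 ^ (k + 2)) K hρ0 hle hy (by rw [e3]; exact h1)
      simp only [e1, e2] at this
      exact this
    · rintro y - z ⟨hz, -⟩
      rw [mem_ball, dist_comm] at hz
      have hmono : ∀ i ≤ k, dist y z < R / 2 ^ (i + 2) := fun i hi =>
        hz.trans_le (div_le_div_of_nonneg_left hR0.le (by positivity)
          (pow_le_pow_right₀ (by norm_num) (by omega)))
      have h1 : a (k + 2) y ≤ D * (D * a k z) := by
        refine (hshift (k + 1) y z (hmono k le_rfl)).trans ?_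
        gcongr
        refine hshift k z z ?_
        rw [dist_self]; positivity
      have h2 : S k y ≤ D * (T z + M z) := by
        calc S k y ≤ ∑ i ∈ Finset.range (k + 1), D * a (i + 1) z :=
              Finset.sum_le_sum fun i hi =>
                hshift (i + 1) y z (hmono i (by rw [Finset.mem_range] at hi; omega))
          _ = D * (∑ i ∈ Finset.range k, a (i + 2) z + a 1 z) := by
              rw [← Finset.mul_sum, Finset.sum_range_succ']
          _ ≤ D * (T z + M z) := by
              gcongr
              · exact Finset.sum_le_sum_of_subset (Finset.range_mono hk.le)
              · exact haM 1 z
      calc a (k + 2) y * S k y ^ (p - 1) ≤ D * (D * a k z) * (D * (T z + M z)) ^ (p - 1) := by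
            gcongr
        _ = H k z := by
            rw [ENNReal.mul_rpow_of_nonneg _ _ hp1, hH]; ring
  have hgood : ∀ z, ∑ k ∈ Finset.range K, (G k).indicator (H k) z ≤
      D * D * D ^ (p - 1) * ((m + 2 : ℕ) + 1) * (M z * (T z + M z) ^ (p - 1)) := by
    intro z
    classical
    calc ∑ k ∈ Finset.range K, (G k).indicator (H k) z
        = ∑ k ∈ Finset.range K with z ∈ G k, H k z := by
          simp only [Finset.sum_filter, indicator_apply]
      _ = D * D * D ^ (p - 1) * (T z + M z) ^ (p - 1) *
            ∑ k ∈ Finset.range K with z ∈ G k, a k z := by rw [Finset.mul_sum]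
      _ ≤ D * D * D ^ (p - 1) * (T z + M z) ^ (p - 1) * (((m + 2 : ℕ) + 1) * M z) := by
          gcongr
          exact sum_filter_le_of_tail_le (fun k => a k z) (M z) (fun k => haM k z) (m + 2) K _
            (Finset.filter_subset _ _) fun k hk => (Finset.mem_filter.1 hk).2
      _ = _ := by ring
  have hmain : ∫⁻ y in ball x r, T y ^ p ∂μ ≤
      2⁻¹ * ∫⁻ y in ball x r, T y ^ p ∂μ + C' * ∫⁻ y in ball x r, M y ^ p ∂μ := by
    calc ∫⁻ y in ball x r, T y ^ p ∂μ
        ≤ ∫⁻ y in ball x r, ENNReal.ofReal p *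
            ∑ k ∈ Finset.range K, a (k + 2) y * S k y ^ (p - 1) ∂μ :=
          lintegral_mono fun y => sum_range_rpow_le hp.le (fun k => a (k + 2) y)
            (fun k => hat _ y) K
      _ = ENNReal.ofReal p *
            ∑ k ∈ Finset.range K, ∫⁻ y in ball x r, a (k + 2) y * S k y ^ (p - 1) ∂μ := by
          have hm : ∀ k, Measurable fun y => a (k + 2) y * S k y ^ (p - 1) := fun k =>
            (ham _).mul ((hSm k).pow_const _)
          rw [lintegral_const_mul _ (Finset.measurable_sum _ fun k _ => hm k),
            lintegral_finsetSum _ fun k _ => hm k]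
      _ ≤ ENNReal.ofReal p *
            ∑ k ∈ Finset.range K, C₁ * ∫⁻ z in ball x r, (G k).indicator (H k) z ∂μ := by
          gcongr with k hk
          exact hscale k (Finset.mem_range.1 hk)
      _ = ENNReal.ofReal p * (C₁ * ∫⁻ z in ball x r,
            ∑ k ∈ Finset.range K, (G k).indicator (H k) z ∂μ) := by
          rw [lintegral_finsetSum _ fun k _ => (hHm k).indicator (hGm k), ← Finset.mul_sum]
      _ ≤ ENNReal.ofReal p * (C₁ * ∫⁻ z in ball x r,
            D * D * D ^ (p - 1) * ((m + 2 : ℕ) + 1) * (M z * (T z + M z) ^ (p - 1)) ∂μ) := by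
          gcongr with z
          exact hgood z
      _ = ∫⁻ z in ball x r, C₂ * (M z * (T z + M z) ^ (p - 1)) ∂μ := by
          have hm : Measurable fun z => M z * (T z + M z) ^ (p - 1) :=
            hMm.mul ((hTm.add hMm).pow_const _)
          rw [lintegral_const_mul _ hm, lintegral_const_mul _ hm, hC₂]
          ring
      _ ≤ ∫⁻ z in ball x r, (2⁻¹ * T z ^ p + C' * M z ^ p) ∂μ :=
          lintegral_mono fun z => hC' (T z) (M z)
      _ = _ := by
          rw [lintegral_add_left ((hTm.pow_const _).const_mul _),
            lintegral_const_mul _ (hTm.pow_const _), lintegral_const_mul _ (hMm.pow_const _)]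
  set X := ∫⁻ y in ball x r, T y ^ p ∂μ with hX
  -- the truncation of the sum at `K` makes the absorbed term finite
  have hXt : X ≠ ∞ := (setLIntegral_sum_ballAvg_rpow_lt_top (by linarith) d μ ν x r _ _).ne
  have h1 : 2⁻¹ * X + 2⁻¹ * X ≤ 2⁻¹ * X + C' * ∫⁻ y in ball x r, M y ^ p ∂μ := by
    conv_lhs => rw [← add_mul, ENNReal.inv_two_add_inv_two, one_mul]
    exact hmain
  have h2 := (ENNReal.add_le_add_iff_left (ENNReal.mul_ne_top (by simp) hXt)).1 h1
  calc X = 2 * (2⁻¹ * X) := by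
        rw [← mul_assoc, ENNReal.mul_inv_cancel (by simp) (by simp), one_mul]
    _ ≤ 2 * (C' * ∫⁻ y in ball x r, M y ^ p ∂μ) := by gcongr
    _ = _ := by push_cast; ring

/-- The full sum over all scales, in terms of `L ^ p` norms; the truncated sums increase to it. -/
lemma exists_rpow_setLIntegral_tsum_le {p d : ℝ} (hp : 1 < p) (hd0 : 0 < d) (hd : d < n)
    {μ : Measure (EuclideanSpace ℝ (Fin n))} [SFinite μ] [IsLocallyFiniteMeasure μ]
    [μ.IsOpenPosMeasure] (hμ : FatSets μ) :
    ∃ C : ℝ≥0, ∀ (ν : Measure (EuclideanSpace ℝ (Fin n))) [IsLocallyFiniteMeasure ν]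
      [SFinite ν] (x : EuclideanSpace ℝ (Fin n)) (r : ℝ), 0 < r →
      (∫⁻ y in ball x r, (∑' k : ℕ, ballAvg d ν (16 * r / 2 ^ (k + 2)) y) ^ p ∂μ) ^ (1 / p) ≤
        C * (∫⁻ y in ball x r, (⨆ k : ℕ, ballAvg d ν (16 * r / 2 ^ k) y) ^ p ∂μ) ^ (1 / p) := by
  have hp0 : 0 < p := by linarith
  obtain ⟨C, hC⟩ := exists_setLIntegral_sum_rpow_le hp hd0 hd hμ
  refine ⟨C ^ (1 / p), fun ν _ _ x r hr => ?_⟩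
  rw [ENNReal.coe_rpow_of_nonneg _ (by positivity), ← ENNReal.mul_rpow_of_nonneg _ _
    (by positivity)]
  refine ENNReal.rpow_le_rpow ?_ (by positivity)
  have hsup : ∀ y, (∑' k : ℕ, ballAvg d ν (16 * r / 2 ^ (k + 2)) y) ^ p =
      ⨆ K : ℕ, (∑ k ∈ Finset.range K, ballAvg d ν (16 * r / 2 ^ (k + 2)) y) ^ p := fun y => by
    rw [ENNReal.tsum_eq_iSup_nat]
    exact (ENNReal.orderIsoRpow p hp0).map_iSup _
  simp_rw [hsup]
  rw [lintegral_iSup]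
  · exact iSup_le fun K => hC ν x r K hr
  · exact fun K => (Finset.measurable_sum _ fun k _ => measurable_ballAvg d ν _).pow_const _
  · intro K L hKL y
    exact ENNReal.rpow_le_rpow (Finset.sum_le_sum_of_subset (Finset.range_mono hKL)) hp0.le

/-! ### The Riesz potential and averages over balls -/

lemma inv_ofReal_rpow {t : ℝ} (ht : 0 < t) (d : ℝ) :
    (ENNReal.ofReal (t ^ d))⁻¹ = ENNReal.ofReal (t ^ (-d)) := by
  rw [← ENNReal.ofReal_inv_of_pos (by positivity), Real.rpow_neg ht.le]

/-- Off the diagonal, the kernel is dominated by a dyadic sum of normalized indicators. At `w = y`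
the left side is `0⁻¹ = ∞`. -/
lemma inv_ofReal_norm_rpow_le_tsum {d s : ℝ} (hd : 0 < d) {y w : EuclideanSpace ℝ (Fin n)}
    (hw : w ∈ ball y s) (hne : w ≠ y) :
    (ENNReal.ofReal (‖y - w‖ ^ d))⁻¹ ≤ ENNReal.ofReal (4 ^ d) * ∑' k : ℕ,
      ENNReal.ofReal ((2 * s / 2 ^ k) ^ (-d)) * (ball y (2 * s / 2 ^ k)).indicator 1 w := by
  rw [mem_ball, dist_comm, dist_eq_norm] at hw
  set t := ‖y - w‖ with ht
  have ht0 : 0 < t := norm_pos_iff.2 (sub_ne_zero.2 hne.symm)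
  have hs0 : 0 < s := ht0.trans hw
  obtain ⟨k, hk1, hk2⟩ := exists_nat_pow_near (x := s / t) (y := 2)
    ((one_le_div ht0).2 hw.le) (by norm_num)
  rw [le_div_iff₀ ht0] at hk1
  rw [div_lt_iff₀ ht0, pow_succ] at hk2
  have h2k : (0 : ℝ) < 2 ^ k := by positivity
  have hmem : w ∈ ball y (2 * s / 2 ^ k) := by
    rw [mem_ball, dist_comm, dist_eq_norm, lt_div_iff₀ h2k]
    linarith
  refine le_trans ?_ (mul_le_mul_right (ENNReal.le_tsum k) _)
  rw [indicator_of_mem hmem, Pi.one_apply, mul_one, inv_ofReal_rpow ht0,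
    ← ENNReal.ofReal_mul (by positivity)]
  refine ENNReal.ofReal_le_ofReal ?_
  have h4 : (4 : ℝ) ^ d = (1 / 4) ^ (-d) := by
    rw [one_div, Real.inv_rpow (by norm_num), Real.rpow_neg (by norm_num), inv_inv]
  rw [h4, ← Real.mul_rpow (by norm_num) (by positivity)]
  refine Real.rpow_le_rpow_of_nonpos (by positivity) ?_ (by linarith)
  rw [← mul_div_assoc, div_le_iff₀ h2k]
  linarith

lemma setLIntegral_ball_riesz_le {d s : ℝ} (hd : 0 < d)
    (ν : Measure (EuclideanSpace ℝ (Fin n))) (y : EuclideanSpace ℝ (Fin n)) (hν : ν {y} = 0) :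
    ∫⁻ w in ball y s, (ENNReal.ofReal (‖y - w‖ ^ d))⁻¹ ∂ν ≤
      ENNReal.ofReal (4 ^ d) * ∑' k : ℕ, ballAvg d ν (2 * s / 2 ^ k) y := by
  have hne : ∀ᵐ w ∂ν, w ≠ y := by
    rw [ae_iff]; simpa using hν
  have hm : ∀ k : ℕ, Measurable fun w => ENNReal.ofReal ((2 * s / 2 ^ k) ^ (-d)) *
      (ball y (2 * s / 2 ^ k)).indicator (1 : EuclideanSpace ℝ (Fin n) → ℝ≥0∞) w := fun k =>
    (measurable_one.indicator measurableSet_ball).const_mul _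
  calc ∫⁻ w in ball y s, (ENNReal.ofReal (‖y - w‖ ^ d))⁻¹ ∂ν
      ≤ ∫⁻ w in ball y s, ENNReal.ofReal (4 ^ d) * ∑' k : ℕ,
          ENNReal.ofReal ((2 * s / 2 ^ k) ^ (-d)) *
            (ball y (2 * s / 2 ^ k)).indicator 1 w ∂ν := by
        refine lintegral_mono_ae ?_
        filter_upwards [ae_restrict_mem measurableSet_ball, ae_restrict_of_ae hne] with w h1 h2
        exact inv_ofReal_norm_rpow_le_tsum hd h1 h2
    _ ≤ ∫⁻ w, ENNReal.ofReal (4 ^ d) * ∑' k : ℕ, ENNReal.ofReal ((2 * s / 2 ^ k) ^ (-d)) *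
            (ball y (2 * s / 2 ^ k)).indicator 1 w ∂ν := setLIntegral_le_lintegral _ _
    _ = _ := by
        rw [lintegral_const_mul _ (Measurable.tsum hm),
          lintegral_tsum fun k => (hm k).aemeasurable]
        congr 2 with k
        rw [lintegral_const_mul _ (measurable_one.indicator measurableSet_ball),
          lintegral_indicator_one measurableSet_ball, ballAvg]

lemma lintegral_Ioi_rpow {d T : ℝ} (hd : 0 < d) (hT : 0 < T) :
    ∫⁻ t in Ioi T, ENNReal.ofReal (t ^ (-d - 1)) = ENNReal.ofReal (T ^ (-d) / d) := by
  rw [← ofReal_integral_eq_lintegral_ofReal (integrableOn_Ioi_rpow_of_lt (by linarith) hT),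
    integral_Ioi_rpow_of_lt (by linarith) hT]
  · congr 1
    rw [sub_add_cancel, neg_div_neg_eq]
  · filter_upwards [ae_restrict_mem measurableSet_Ioi] with t ht
    exact Real.rpow_nonneg (hT.trans ht).le _

/-- The kernel at a point far from `y` is a superposition of indicators of balls centred at `x`
with radius greater than `r`. -/
lemma inv_ofReal_norm_rpow_le_lintegral {d r : ℝ} (hd : 0 < d) (hr : 0 < r)
    {x y w : EuclideanSpace ℝ (Fin n)} (hy : y ∈ ball x r) (hw : w ∉ ball y (2 * r)) :
    (ENNReal.ofReal (‖y - w‖ ^ d))⁻¹ ≤ ENNReal.ofReal (2 ^ d * d) *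
      ∫⁻ t in Ioi r, ENNReal.ofReal (t ^ (-d - 1)) * (ball x t).indicator 1 w := by
  rw [mem_ball] at hy hw
  rw [← dist_eq_norm]
  set T := dist w x with hT
  have h1 : T ≤ dist w y + dist y x := dist_triangle _ _ _
  have h2 : dist w y ≤ T + dist y x := by
    rw [dist_comm y x]; exact dist_triangle _ _ _
  have hrT : r < T := by linarith
  have hTy : T ≤ 2 * dist y w := by rw [dist_comm y w]; linarith
  have hT0 : 0 < T := hr.trans hrT
  have hyw : 0 < dist y w := by linarith
  calc (ENNReal.ofReal (dist y w ^ d))⁻¹ = ENNReal.ofReal (dist y w ^ (-d)) :=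
        inv_ofReal_rpow hyw d
    _ ≤ ENNReal.ofReal (2 ^ d * d * (T ^ (-d) / d)) := by
        refine ENNReal.ofReal_le_ofReal ?_
        calc dist y w ^ (-d) ≤ (T / 2) ^ (-d) :=
              Real.rpow_le_rpow_of_nonpos (by positivity) (by linarith) (by linarith)
          _ = 2 ^ d * T ^ (-d) := by
              rw [Real.div_rpow hT0.le (by norm_num), Real.rpow_neg (by norm_num : (0 : ℝ) ≤ 2),
                div_inv_eq_mul, mul_comm]
          _ = _ := by field_simp
    _ = ENNReal.ofReal (2 ^ d * d) * ∫⁻ t in Ioi T, ENNReal.ofReal (t ^ (-d - 1)) := by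
        rw [lintegral_Ioi_rpow hd hT0, ENNReal.ofReal_mul (by positivity)]
    _ = ENNReal.ofReal (2 ^ d * d) *
          ∫⁻ t in Ioi T, ENNReal.ofReal (t ^ (-d - 1)) * (ball x t).indicator 1 w := by
        congr 1
        refine setLIntegral_congr_fun measurableSet_Ioi fun t ht => ?_
        have : w ∈ ball x t := ht
        simp [indicator_of_mem this]
    _ ≤ _ := by
        gcongr

lemma setLIntegral_compl_ball_riesz_le {d r : ℝ} (hd : 0 < d) (hr : 0 < r)
    (ν : Measure (EuclideanSpace ℝ (Fin n))) [SFinite ν] {x y : EuclideanSpace ℝ (Fin n)}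
    (hy : y ∈ ball x r) :
    ∫⁻ w in (ball y (2 * r))ᶜ, (ENNReal.ofReal (‖y - w‖ ^ d))⁻¹ ∂ν ≤
      ENNReal.ofReal (2 ^ d * d) *
        ∫⁻ t in Ioi r, ENNReal.ofReal (t ^ (-d - 1)) * ν (ball x t) := by
  have hmeas : Measurable fun q : EuclideanSpace ℝ (Fin n) × ℝ =>
      ENNReal.ofReal (q.2 ^ (-d - 1)) *
        (ball x q.2).indicator (1 : EuclideanSpace ℝ (Fin n) → ℝ≥0∞) q.1 := by
    have hs : MeasurableSet {q : EuclideanSpace ℝ (Fin n) × ℝ | dist q.1 x < q.2} :=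
      measurableSet_lt (measurable_fst.dist measurable_const) measurable_snd
    exact (measurable_snd.pow_const _).ennreal_ofReal.mul (measurable_one.indicator hs)
  calc ∫⁻ w in (ball y (2 * r))ᶜ, (ENNReal.ofReal (‖y - w‖ ^ d))⁻¹ ∂ν
      ≤ ∫⁻ w in (ball y (2 * r))ᶜ, ENNReal.ofReal (2 ^ d * d) *
          (∫⁻ t in Ioi r, ENNReal.ofReal (t ^ (-d - 1)) * (ball x t).indicator 1 w) ∂ν :=
        setLIntegral_mono' measurableSet_ball.compl fun w hw =>
          inv_ofReal_norm_rpow_le_lintegral hd hr hy hw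
    _ ≤ ∫⁻ w, ENNReal.ofReal (2 ^ d * d) *
          (∫⁻ t in Ioi r, ENNReal.ofReal (t ^ (-d - 1)) * (ball x t).indicator 1 w) ∂ν :=
        setLIntegral_le_lintegral _ _
    _ = ENNReal.ofReal (2 ^ d * d) * ∫⁻ t in Ioi r, (∫⁻ w,
          ENNReal.ofReal (t ^ (-d - 1)) * (ball x t).indicator 1 w ∂ν) := by
        rw [lintegral_const_mul _ (Measurable.lintegral_prod_right' hmeas),
          lintegral_lintegral_swap hmeas.aemeasurable]
    _ = _ := by
        congr 2 with t
        rw [lintegral_const_mul _ (measurable_one.indicator measurableSet_ball),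
          lintegral_indicator_one measurableSet_ball]

lemma ballAvg_le_riesz {d ρ : ℝ} (hd : 0 < d) (hρ : 0 < ρ)
    (ν : Measure (EuclideanSpace ℝ (Fin n))) (y : EuclideanSpace ℝ (Fin n)) :
    ballAvg d ν ρ y ≤ ∫⁻ w, (ENNReal.ofReal (‖y - w‖ ^ d))⁻¹ ∂ν := by
  rw [ballAvg, ← inv_ofReal_rpow hρ, ← setLIntegral_const]
  refine (setLIntegral_mono' measurableSet_ball fun w hw => ?_).trans
    (setLIntegral_le_lintegral _ _)
  rw [mem_ball, dist_comm, dist_eq_norm] at hw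
  gcongr

/-! ### Reformulation of the operators and norms through measures -/

/-- The power of the volume of the unit ball by which averages with respect to powers of the radius
and with respect to powers of the volume differ. -/
noncomputable def unitBallConst (n : ℕ) (α : ℝ) : ℝ≥0∞ :=
  volume (ball (0 : EuclideanSpace ℝ (Fin n)) 1) ^ (1 - α / (n : ℝ))

lemma unitBallConst_ne_zero (n : ℕ) (α : ℝ) : unitBallConst n α ≠ 0 :=
  (ENNReal.rpow_pos (measure_ball_pos _ _ one_pos) measure_ball_lt_top.ne).ne'

lemma unitBallConst_ne_top (n : ℕ) (α : ℝ) : unitBallConst n α ≠ ∞ :=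
  ENNReal.rpow_ne_top_of_ne_zero (measure_ball_pos _ _ one_pos).ne' measure_ball_lt_top.ne

lemma fracMaximal_eq (hn : 0 < n) (α : ℝ) (f : EuclideanSpace ℝ (Fin n) → ℝ)
    (y : EuclideanSpace ℝ (Fin n)) :
    fracMaximal α f y = ⨆ ρ : ℝ, ⨆ _ : 0 < ρ, ballAvg ((n : ℝ) - α)
      (volume.withDensity fun x => ENNReal.ofReal (f x)) ρ y / unitBallConst n α := by
  have hn' : (n : ℝ) ≠ 0 := by exact_mod_cast hn.ne'
  refine iSup_congr fun ρ => iSup_congr fun hρ => ?_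
  rw [ballAvg, withDensity_apply _ measurableSet_ball, unitBallConst, volume_ball_eq hn y hρ.le,
    ENNReal.mul_rpow_of_ne_top ENNReal.ofReal_ne_top measure_ball_lt_top.ne,
    ENNReal.ofReal_rpow_of_pos (by positivity), ← Real.rpow_mul hρ.le,
    show (n : ℝ) * (1 - α / n) = n - α by field_simp, ENNReal.div_eq_inv_mul, ENNReal.div_eq_inv_mul,
    ENNReal.mul_inv (Or.inr (ENNReal.rpow_ne_top_of_ne_zero (measure_ball_pos _ _ one_pos).ne'
      measure_ball_lt_top.ne)) (Or.inl ENNReal.ofReal_ne_top), inv_ofReal_rpow hρ]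
  ring

lemma rieszPotential_eq (α : ℝ) {f : EuclideanSpace ℝ (Fin n) → ℝ}
    (hf : LocallyIntegrable f volume) (y : EuclideanSpace ℝ (Fin n)) :
    rieszPotential α f y = ∫⁻ w, (ENNReal.ofReal (‖y - w‖ ^ ((n : ℝ) - α)))⁻¹
      ∂(volume.withDensity fun x => ENNReal.ofReal (f x)) := by
  rw [lintegral_withDensity_eq_lintegral_mul_non_measurable₀ _
    hf.aestronglyMeasurable.aemeasurable.ennreal_ofReal (ae_of_all _ fun _ => ENNReal.ofReal_lt_top)]
  rfl

lemma wLpNorm_eq (p : ℝ) {v : EuclideanSpace ℝ (Fin n) → ℝ} (hv : LocallyIntegrable v volume)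
    {S : Set (EuclideanSpace ℝ (Fin n))} (hS : MeasurableSet S)
    (g : EuclideanSpace ℝ (Fin n) → ℝ≥0∞) :
    wLpNorm p v S g = (∫⁻ y in S, g y ^ p
      ∂(volume.withDensity fun x => ENNReal.ofReal (v x))) ^ (1 / p) := by
  rw [setLIntegral_withDensity_eq_setLIntegral_mul_non_measurable₀ _
    hv.aestronglyMeasurable.aemeasurable.ennreal_ofReal.restrict _ hS
    (ae_of_all _ fun _ => ENNReal.ofReal_lt_top), wLpNorm]
  simp only [Pi.mul_apply, mul_comm]

lemma morreyNorm_le_mul {p : ℝ} (hp : 0 < p) {ω : EuclideanSpace ℝ (Fin n) → ℝ → ℝ}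
    {v : EuclideanSpace ℝ (Fin n) → ℝ} {g h : EuclideanSpace ℝ (Fin n) → ℝ≥0∞} {c : ℝ≥0∞}
    (hc : c ≠ ∞) (hgh : ∀ x, g x ≤ c * h x) : morreyNorm p ω v g ≤ c * morreyNorm p ω v h := by
  refine iSup_le fun x => iSup_le fun r => iSup_le fun hr => ?_
  have h1 : wLpNorm p v (ball x r) g ≤ c * wLpNorm p v (ball x r) h := by
    calc wLpNorm p v (ball x r) g
        ≤ (∫⁻ y in ball x r, c ^ p * (h y ^ p * ENNReal.ofReal (v y))) ^ (1 / p) := by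
          refine ENNReal.rpow_le_rpow (lintegral_mono fun y => ?_) (by positivity)
          rw [← mul_assoc, ← ENNReal.mul_rpow_of_nonneg _ _ hp.le]
          gcongr
          exact hgh y
      _ = c * wLpNorm p v (ball x r) h := by
          rw [lintegral_const_mul' _ _ (ENNReal.rpow_ne_top_of_nonneg hp.le hc),
            ENNReal.mul_rpow_of_nonneg _ _ (by positivity), ← ENNReal.rpow_mul,
            mul_one_div_cancel hp.ne', ENNReal.rpow_one, wLpNorm]
  calc ENNReal.ofReal (ω x r) * wLpNorm p v (ball x r) g
      ≤ ENNReal.ofReal (ω x r) * (c * wLpNorm p v (ball x r) h) := by gcongr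
    _ = c * (ENNReal.ofReal (ω x r) * wLpNorm p v (ball x r) h) := by ring
    _ ≤ _ := by
        gcongr
        exact le_iSup_of_le x (le_iSup_of_le r (le_iSup_of_le hr le_rfl))

/-! ### The two parts of the Riesz potential in the Morrey norm -/

lemma morreyNorm_fracMaximal_le {p α : ℝ} (hp : 0 < p) (hn : 0 < n) (hαn : α < (n : ℝ))
    (ω : EuclideanSpace ℝ (Fin n) → ℝ → ℝ) (v : EuclideanSpace ℝ (Fin n) → ℝ)
    {f : EuclideanSpace ℝ (Fin n) → ℝ} (hf : LocallyIntegrable f volume) :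
    morreyNorm p ω v (fracMaximal α f) ≤
      (unitBallConst n α)⁻¹ * morreyNorm p ω v (rieszPotential α f) := by
  refine morreyNorm_le_mul hp (ENNReal.inv_ne_top.2 (unitBallConst_ne_zero n α)) fun y => ?_
  rw [fracMaximal_eq hn, rieszPotential_eq α hf]
  refine iSup_le fun ρ => iSup_le fun hρ => ?_
  rw [ENNReal.div_eq_inv_mul]
  gcongr
  exact ballAvg_le_riesz (by linarith) hρ _ y

lemma ballAvg_le_mul_fracMaximal (hn : 0 < n) (α : ℝ) (f : EuclideanSpace ℝ (Fin n) → ℝ)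
    {ρ : ℝ} (hρ : 0 < ρ) (y : EuclideanSpace ℝ (Fin n)) :
    ballAvg ((n : ℝ) - α) (volume.withDensity fun x => ENNReal.ofReal (f x)) ρ y ≤
      unitBallConst n α * fracMaximal α f y := by
  rw [← ENNReal.div_le_iff' (unitBallConst_ne_zero n α) (unitBallConst_ne_top n α),
    fracMaximal_eq hn]
  exact le_iSup_of_le ρ (le_iSup_of_le hρ le_rfl)

/-- A ball `B(x, t)` carrying mass makes the maximal function large on every ball `B(x, τ)` with
`τ < s` and `t < s`; hence the mass is controlled by `psi` and the Morrey norm. -/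
lemma psi_mul_le {p α : ℝ} (hp : 0 < p) (hn : 0 < n)
    (ω : EuclideanSpace ℝ (Fin n) → ℝ → ℝ) {v : EuclideanSpace ℝ (Fin n) → ℝ}
    (hv : LocallyIntegrable v volume) (f : EuclideanSpace ℝ (Fin n) → ℝ)
    (x : EuclideanSpace ℝ (Fin n)) {t : ℝ} (ht : 0 < t) :
    psi p α ω v x t * volume.withDensity (fun y => ENNReal.ofReal (f y)) (ball x t) ≤
      ENNReal.ofReal (2 ^ ((n : ℝ) - α)) * unitBallConst n α *
        morreyNorm p ω v (fracMaximal α f) := by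
  set d : ℝ := n - α with hd
  set ν : Measure (EuclideanSpace ℝ (Fin n)) :=
    volume.withDensity (fun y => ENNReal.ofReal (f y)) with hν
  set D : ℝ≥0∞ := ENNReal.ofReal (2 ^ d) * unitBallConst n α with hD
  simp only [psi, ENNReal.mul_iSup, ENNReal.iSup_mul]
  refine iSup_le fun s => iSup_le fun hs => iSup_le fun τ => iSup_le fun hτ => ?_
  rw [mem_Ioi] at hs
  have hs0 : 0 < s := ht.trans hs
  set e : ℝ≥0∞ := ENNReal.ofReal (s ^ (α - (n : ℝ))) * ν (ball x t) with he
  have hpt : ∀ y ∈ ball x τ, e ≤ D * fracMaximal α f y := by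
    intro y hy
    have hyx : dist x y < s := by
      rw [dist_comm]; exact (mem_ball.1 hy).trans hτ.2
    calc e ≤ ballAvg d ν s x := by
          rw [he, ballAvg, hd, neg_sub]
          gcongr
      _ ≤ ENNReal.ofReal (2 ^ d) * ballAvg d ν (2 * s) y :=
          ballAvg_le_of_subset ν hs0 (ball_subset_ball_two_mul hyx)
      _ ≤ ENNReal.ofReal (2 ^ d) * (unitBallConst n α * fracMaximal α f y) := by
          gcongr
          exact ballAvg_le_mul_fracMaximal hn α f (by positivity) y
      _ = _ := by rw [hD, mul_assoc]
  have hDt : D ≠ ∞ := ENNReal.mul_ne_top ENNReal.ofReal_ne_top (unitBallConst_ne_top n α)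
  have hnorm : e * wMeas v (ball x τ) ^ (1 / p) ≤ D * wLpNorm p v (ball x τ) (fracMaximal α f) := by
    rw [wLpNorm_eq p hv measurableSet_ball, wMeas_eq_withDensity]
    set μ : Measure (EuclideanSpace ℝ (Fin n)) :=
      volume.withDensity (fun y => ENNReal.ofReal (v y)) with hμ
    calc e * μ (ball x τ) ^ (1 / p) = (e ^ p * μ (ball x τ)) ^ (1 / p) := by
          rw [ENNReal.mul_rpow_of_nonneg _ _ (by positivity), ← ENNReal.rpow_mul,
            mul_one_div_cancel hp.ne', ENNReal.rpow_one]
      _ = (∫⁻ _y in ball x τ, e ^ p ∂μ) ^ (1 / p) := by rw [setLIntegral_const]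
      _ ≤ (∫⁻ y in ball x τ, D ^ p * fracMaximal α f y ^ p ∂μ) ^ (1 / p) := by
          refine ENNReal.rpow_le_rpow (setLIntegral_mono' measurableSet_ball fun y hy => ?_)
            (by positivity)
          rw [← ENNReal.mul_rpow_of_nonneg _ _ hp.le]
          exact ENNReal.rpow_le_rpow (hpt y hy) hp.le
      _ = _ := by
          rw [lintegral_const_mul' _ _ (ENNReal.rpow_ne_top_of_nonneg hp.le hDt),
            ENNReal.mul_rpow_of_nonneg _ _ (by positivity), ← ENNReal.rpow_mul,
            mul_one_div_cancel hp.ne', ENNReal.rpow_one]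
  calc _ = ENNReal.ofReal (ω x τ) * (e * wMeas v (ball x τ) ^ (1 / p)) := by rw [he]; ring
    _ ≤ ENNReal.ofReal (ω x τ) * (D * wLpNorm p v (ball x τ) (fracMaximal α f)) := by gcongr
    _ = D * (ENNReal.ofReal (ω x τ) * wLpNorm p v (ball x τ) (fracMaximal α f)) := by ring
    _ ≤ _ := by
        gcongr
        exact le_iSup_of_le x (le_iSup_of_le τ (le_iSup_of_le hτ.1 le_rfl))

/-- The supremum defining `psi` at `r`, evaluated at `s = 2 * r` and `τ = r`. -/
lemma le_mul_psi (p α : ℝ) (ω : EuclideanSpace ℝ (Fin n) → ℝ → ℝ)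
    (v : EuclideanSpace ℝ (Fin n) → ℝ) (x : EuclideanSpace ℝ (Fin n)) {r : ℝ} (hr : 0 < r) :
    ENNReal.ofReal (ω x r) * wMeas v (ball x r) ^ (1 / p) ≤
      ENNReal.ofReal (2 ^ ((n : ℝ) - α)) * (ENNReal.ofReal (r ^ ((n : ℝ) - α)) *
        psi p α ω v x r) := by
  have h : ENNReal.ofReal ((2 * r) ^ (α - (n : ℝ))) *
      (ENNReal.ofReal (ω x r) * wMeas v (ball x r) ^ (1 / p)) ≤ psi p α ω v x r := by
    refine le_iSup₂_of_le (2 * r) (by rw [mem_Ioi]; linarith) ?_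
    gcongr
    exact le_iSup₂_of_le (f := fun τ (_ : τ ∈ Ioo 0 (2 * r)) =>
      ENNReal.ofReal (ω x τ) * wMeas v (ball x τ) ^ (1 / p)) r ⟨hr, by linarith⟩ le_rfl
  refine le_trans (le_of_eq ?_) (mul_le_mul_right (mul_le_mul_right h _) _)
  rw [← mul_assoc, ← mul_assoc, ← ENNReal.ofReal_mul (by positivity),
    ← Real.mul_rpow (by norm_num) hr.le, ← ENNReal.ofReal_mul (by positivity),
    ← Real.rpow_add (by positivity), show (n : ℝ) - α + (α - n) = 0 by ring, Real.rpow_zero,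
    ENNReal.ofReal_one, one_mul]

/-- The nontrivial half of the equivalence. On `B(x, r)` the potential is split at distance `2 r`
from the variable point: the near part is handled by the local comparison, the far part by the
bound for the mass of `B(x, t)` in terms of `psi`. -/
theorem exists_morreyNorm_rieszPotential_le {p α : ℝ} (hp : 1 < p) (hα : 0 < α)
    (hαn : α < (n : ℝ)) {v : EuclideanSpace ℝ (Fin n) → ℝ} (hv : MuckenhouptAInfty v)
    {ω : EuclideanSpace ℝ (Fin n) → ℝ → ℝ}
    (hω_pos : ∀ (x : EuclideanSpace ℝ (Fin n)) (r : ℝ), 0 < r → 0 < ω x r)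
    (hψ : (⨆ x : EuclideanSpace ℝ (Fin n), ⨆ s : ℝ, ⨆ _ : 0 < s,
      ENNReal.ofReal (s ^ ((n : ℝ) - α)) * psi p α ω v x s *
        ∫⁻ t in Ioi s, ENNReal.ofReal (t ^ (α - (n : ℝ) - 1)) * (psi p α ω v x t)⁻¹) < ∞) :
    ∃ C : ℝ≥0, 0 < C ∧ ∀ f : EuclideanSpace ℝ (Fin n) → ℝ, LocallyIntegrable f volume →
      morreyNorm p ω v (rieszPotential α f) ≤ C * morreyNorm p ω v (fracMaximal α f) := by
  have hp0 : 0 < p := by linarith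
  have hn : 0 < n := by exact_mod_cast hα.trans hαn
  have hw : IsWeight v := hv.isWeight
  set d : ℝ := n - α with hd
  have hd0 : 0 < d := by linarith
  have hαd : α - (n : ℝ) = -d := by rw [hd]; ring
  set μ : Measure (EuclideanSpace ℝ (Fin n)) :=
    volume.withDensity (fun y => ENNReal.ofReal (v y)) with hμ
  have : IsLocallyFiniteMeasure μ := isLocallyFiniteMeasure_withDensity hw.1
  have : μ.IsOpenPosMeasure := hw.isOpenPosMeasure
  obtain ⟨C₁, hC₁⟩ := exists_rpow_setLIntegral_tsum_le hp hd0 (by linarith : d < n)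
    (hv.fatSets hn)
  set κ := unitBallConst n α with hκ
  have hκt : κ ≠ ∞ := unitBallConst_ne_top n α
  set D : ℝ≥0∞ := ENNReal.ofReal (2 ^ d) with hD
  set P := ⨆ x : EuclideanSpace ℝ (Fin n), ⨆ s : ℝ, ⨆ _ : 0 < s,
      ENNReal.ofReal (s ^ d) * psi p α ω v x s *
        ∫⁻ t in Ioi s, ENNReal.ofReal (t ^ (α - (n : ℝ) - 1)) * (psi p α ω v x t)⁻¹ with hP
  set A : ℝ≥0∞ := ENNReal.ofReal (4 ^ d) * C₁ * κ +
    ENNReal.ofReal (2 ^ d * d) * (D * κ) * D * P + 1 with hA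
  have hAt : A ≠ ∞ := by
    have := hψ.ne
    finiteness
  refine ⟨A.toNNReal, ?_, fun f hf => ?_⟩
  · exact ENNReal.toNNReal_pos (by simp [hA]) hAt
  rw [ENNReal.coe_toNNReal hAt]
  set N := morreyNorm p ω v (fracMaximal α f) with hN
  -- for finite `N` the bound on masses below also covers `psi = ∞`, where it says that `f` vanishes
  rcases eq_or_ne N ∞ with hNt | hNt
  · rw [hNt, ENNReal.mul_top (by simp [hA])]
    exact le_top
  set ν : Measure (EuclideanSpace ℝ (Fin n)) :=
    volume.withDensity (fun y => ENNReal.ofReal (f y)) with hν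
  have : IsLocallyFiniteMeasure ν := isLocallyFiniteMeasure_withDensity hf
  have : Nonempty (Fin n) := ⟨⟨0, hn⟩⟩
  have hν0 : ∀ y, ν {y} = 0 := fun y => withDensity_absolutelyContinuous _ _ (by simp)
  refine iSup_le fun x => iSup_le fun r => iSup_le fun hr => ?_
  set W : ℝ≥0∞ := ENNReal.ofReal (ω x r) with hW
  set U : EuclideanSpace ℝ (Fin n) → ℝ≥0∞ :=
    fun y => ∑' k : ℕ, ballAvg d ν (16 * r / 2 ^ (k + 2)) y with hU
  have hUm : Measurable U := Measurable.tsum fun k => measurable_ballAvg d ν _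
  set F : ℝ≥0∞ := ENNReal.ofReal (2 ^ d * d) *
    ∫⁻ t in Ioi r, ENNReal.ofReal (t ^ (-d - 1)) * ν (ball x t) with hF
  have hpt : ∀ y ∈ ball x r, rieszPotential α f y ≤ ENNReal.ofReal (4 ^ d) * U y + F := by
    intro y hy
    rw [rieszPotential_eq α hf, ← lintegral_add_compl _ (measurableSet_ball (x := y) (ε := 2 * r))]
    refine add_le_add ?_ (setLIntegral_compl_ball_riesz_le hd0 hr ν hy)
    have h := setLIntegral_ball_riesz_le (s := 2 * r) hd0 ν y (hν0 y)
    have e : ∀ k : ℕ, 2 * (2 * r) / 2 ^ k = 16 * r / 2 ^ (k + 2) := fun k => by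
      rw [pow_add]; field_simp; norm_num
    simpa only [e] using h
  have hnear : (∫⁻ y in ball x r, (ENNReal.ofReal (4 ^ d) * U y) ^ p ∂μ) ^ (1 / p) ≤
      ENNReal.ofReal (4 ^ d) * C₁ * κ * wLpNorm p v (ball x r) (fracMaximal α f) := by
    have h1 : (∫⁻ y in ball x r, (⨆ k : ℕ, ballAvg d ν (16 * r / 2 ^ k) y) ^ p ∂μ) ^ (1 / p) ≤
        κ * wLpNorm p v (ball x r) (fracMaximal α f) := by
      rw [wLpNorm_eq p hw.1 measurableSet_ball]
      calc _ ≤ (∫⁻ y in ball x r, κ ^ p * fracMaximal α f y ^ p ∂μ) ^ (1 / p) := by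
            refine ENNReal.rpow_le_rpow (lintegral_mono fun y => ?_) (by positivity)
            rw [← ENNReal.mul_rpow_of_nonneg _ _ hp0.le]
            refine ENNReal.rpow_le_rpow (iSup_le fun k => ?_) hp0.le
            exact ballAvg_le_mul_fracMaximal hn α f (by positivity) y
        _ = _ := by
            rw [lintegral_const_mul' _ _ (ENNReal.rpow_ne_top_of_nonneg hp0.le hκt),
              ENNReal.mul_rpow_of_nonneg _ _ (by positivity), ← ENNReal.rpow_mul,
              mul_one_div_cancel hp0.ne', ENNReal.rpow_one]
    simp_rw [ENNReal.mul_rpow_of_nonneg _ _ hp0.le]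
    rw [lintegral_const_mul' _ _ (ENNReal.rpow_ne_top_of_nonneg hp0.le ENNReal.ofReal_ne_top),
      ENNReal.mul_rpow_of_nonneg _ _ (by positivity), ← ENNReal.rpow_mul,
      mul_one_div_cancel hp0.ne', ENNReal.rpow_one, mul_assoc, mul_assoc]
    gcongr
    exact (hC₁ ν x r hr).trans (by gcongr)
  have hψ0 : ∀ t, 0 < t → psi p α ω v x t ≠ 0 := by
    intro t ht h0
    have h1 := le_mul_psi p α ω v x ht
    rw [h0, mul_zero, mul_zero, nonpos_iff_eq_zero, mul_eq_zero, ENNReal.rpow_eq_zero_iff,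
      wMeas_eq_withDensity] at h1
    rcases h1 with h | h | h
    · exact (ENNReal.ofReal_pos.2 (hω_pos x t ht)).ne' h
    · exact (measure_ball_pos μ x ht).ne' h.1
    · have : 0 < 1 / p := by positivity
      linarith [h.2]
  have hmass : ∀ t ∈ Ioi r, ν (ball x t) ≤ D * κ * N * (psi p α ω v x t)⁻¹ := by
    intro t ht
    have ht0 : 0 < t := hr.trans ht
    rw [← div_eq_mul_inv, ENNReal.le_div_iff_mul_le (Or.inl (hψ0 t ht0))
      (Or.inr (by finiteness)), mul_comm]
    exact psi_mul_le hp0 hn ω hw.1 f x ht0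
  have hfar : W * (F * wMeas v (ball x r) ^ (1 / p)) ≤
      ENNReal.ofReal (2 ^ d * d) * (D * κ) * D * P * N := by
    have h1 : F ≤ ENNReal.ofReal (2 ^ d * d) * (D * κ * N * ∫⁻ t in Ioi r,
        ENNReal.ofReal (t ^ (α - (n : ℝ) - 1)) * (psi p α ω v x t)⁻¹) := by
      rw [hF, ← lintegral_const_mul' (D * κ * N) _ (by finiteness)]
      refine mul_le_mul_right ?_ _
      refine setLIntegral_mono' measurableSet_Ioi fun t ht => ?_
      rw [hαd]
      calc _ ≤ ENNReal.ofReal (t ^ (-d - 1)) * (D * κ * N * (psi p α ω v x t)⁻¹) := by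
            gcongr; exact hmass t ht
        _ = _ := by ring
    calc W * (F * wMeas v (ball x r) ^ (1 / p))
        = F * (W * wMeas v (ball x r) ^ (1 / p)) := by ring
      _ ≤ (ENNReal.ofReal (2 ^ d * d) * (D * κ * N * ∫⁻ t in Ioi r,
            ENNReal.ofReal (t ^ (α - (n : ℝ) - 1)) * (psi p α ω v x t)⁻¹)) *
            (D * (ENNReal.ofReal (r ^ d) * psi p α ω v x r)) :=
          mul_le_mul' h1 (le_mul_psi p α ω v x hr)
      _ = ENNReal.ofReal (2 ^ d * d) * (D * κ) * D * (ENNReal.ofReal (r ^ d) * psi p α ω v x r *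
            ∫⁻ t in Ioi r, ENNReal.ofReal (t ^ (α - (n : ℝ) - 1)) * (psi p α ω v x t)⁻¹) * N := by
          ring
      _ ≤ _ := by
          gcongr
          exact le_iSup_of_le x (le_iSup_of_le r (le_iSup_of_le hr le_rfl))
  have hsplit : wLpNorm p v (ball x r) (rieszPotential α f) ≤
      (∫⁻ y in ball x r, (ENNReal.ofReal (4 ^ d) * U y) ^ p ∂μ) ^ (1 / p) +
        F * wMeas v (ball x r) ^ (1 / p) := by
    rw [wLpNorm_eq p hw.1 measurableSet_ball, wMeas_eq_withDensity]
    have hmink := ENNReal.lintegral_Lp_add_le (μ := μ.restrict (ball x r))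
      (hUm.const_mul (ENNReal.ofReal (4 ^ d))).aemeasurable (aemeasurable_const (b := F)) hp.le
    refine le_trans ?_ (hmink.trans_eq ?_)
    · exact ENNReal.rpow_le_rpow (setLIntegral_mono' measurableSet_ball fun y hy =>
        ENNReal.rpow_le_rpow (hpt y hy) hp0.le) (by positivity)
    · rw [setLIntegral_const, ENNReal.mul_rpow_of_nonneg (F ^ p) _ (by positivity),
        ← ENNReal.rpow_mul, mul_one_div_cancel hp0.ne', ENNReal.rpow_one]
  calc W * wLpNorm p v (ball x r) (rieszPotential α f)
      ≤ W * (ENNReal.ofReal (4 ^ d) * C₁ * κ * wLpNorm p v (ball x r) (fracMaximal α f) +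
          F * wMeas v (ball x r) ^ (1 / p)) := by
        gcongr
        exact hsplit.trans (add_le_add_left hnear _)
    _ = ENNReal.ofReal (4 ^ d) * C₁ * κ * (W * wLpNorm p v (ball x r) (fracMaximal α f)) +
          W * (F * wMeas v (ball x r) ^ (1 / p)) := by ring
    _ ≤ ENNReal.ofReal (4 ^ d) * C₁ * κ * N +
          ENNReal.ofReal (2 ^ d * d) * (D * κ) * D * P * N := by
        gcongr
        exact le_iSup_of_le x (le_iSup_of_le r (le_iSup_of_le hr le_rfl))
    _ ≤ A * N := by
        rw [← add_mul]
        gcongr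
        exact le_self_add

end Morrey

theorem theorem6p1 {n : ℕ} (p α : ℝ) (hp : 1 < p) (hα : 0 < α) (hαn : α < (n : ℝ))
    (v : EuclideanSpace ℝ (Fin n) → ℝ) (hv : Morrey.MuckenhouptAInfty v)
    (ω : EuclideanSpace ℝ (Fin n) → ℝ → ℝ)
    (hω_cont : ContinuousOn (fun z : EuclideanSpace ℝ (Fin n) × ℝ => ω z.1 z.2)
      (Set.univ ×ˢ Set.Ioi 0))
    (hω_pos : ∀ (x : EuclideanSpace ℝ (Fin n)) (r : ℝ), 0 < r → 0 < ω x r)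
    (hψ : (⨆ x : EuclideanSpace ℝ (Fin n), ⨆ s : ℝ, ⨆ _ : 0 < s,
      ENNReal.ofReal (s ^ ((n : ℝ) - α)) * Morrey.psi p α ω v x s *
        ∫⁻ t in Set.Ioi s,
          ENNReal.ofReal (t ^ (α - (n : ℝ) - 1)) * (Morrey.psi p α ω v x t)⁻¹) < ∞) :
    ∃ C : ℝ≥0, 0 < C ∧
      ∀ f : EuclideanSpace ℝ (Fin n) → ℝ, (∀ x, 0 ≤ f x) → LocallyIntegrable f volume →
        (C : ℝ≥0∞)⁻¹ * Morrey.morreyNorm p ω v (Morrey.fracMaximal α f) ≤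
            Morrey.morreyNorm p ω v (Morrey.rieszPotential α f) ∧
          Morrey.morreyNorm p ω v (Morrey.rieszPotential α f) ≤
            C * Morrey.morreyNorm p ω v (Morrey.fracMaximal α f) := by
  have hp0 : 0 < p := by linarith
  have hn : 0 < n := by exact_mod_cast hα.trans hαn
  obtain ⟨C, hC0, hC⟩ := Morrey.exists_morreyNorm_rieszPotential_le hp hα hαn hv hω_pos hψ
  have hκ0 := Morrey.unitBallConst_ne_zero n α
  have hκt := Morrey.unitBallConst_ne_top n α
  set κ := Morrey.unitBallConst n α with hκ
  have hκ' : ((κ⁻¹.toNNReal : ℝ≥0) : ℝ≥0∞) = κ⁻¹ := ENNReal.coe_toNNReal (ENNReal.inv_ne_top.2 hκ0)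
  refine ⟨C + κ⁻¹.toNNReal, by positivity, fun f _ hf => ⟨?_, (hC f hf).trans ?_⟩⟩
  · rw [ENNReal.inv_mul_le_iff (by simp [hC0.ne']) ENNReal.coe_ne_top, ENNReal.coe_add, hκ']
    refine (Morrey.morreyNorm_fracMaximal_le hp0 hn hαn ω v hf).trans ?_
    gcongr
    exact le_add_self
  · gcongr
    exact le_self_add
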